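/- Let $k\ge 2$ be an integer and let $\beta=(A,B,C,D,E,F)$ be a $6$-tuple of pairwise disjoint nonempty finite sets with $k=|C|=|F|=|A\cup B|=|D\cup E|$. Let $S=A\cup B\cup C\cup D\cup E\cup F$, let $$\mathcal Z=\{S,\ A\cup B\cup D\cup E,\ C\cup B\cup E,\ C\cup A\cup D,\ F\cup E\cup A,\ F\cup D\cup B,\ \varnothing\},$$ and define $r$ on $\mathcal Z$ by $r(S)=2k$, $r(A\cup B\cup D\cup E)=2k-1$, $r(C\cup B\cup E)=k+|B|$, $r(C\cup A\cup D)=k+|A|$, $r(F\cup E\cup A)=k+|E|$, $r(F\cup D\cup B)=k+|D|$, $r(\varnothing)=0$. Let $M_\beta$ be the matroid on $S$ whose independent sets are the sets $I\subseteq S$ with $|I\cap Z|\le r(Z)$ for all $Z\in\mathcal Z$ (that is, the matroid with rank function $X\mapsto\min\{r(Z)+|X-Z|:Z\in\mathcal Z\}$). For bases $B_1,B_2$ of a matroid $M$ and a positive integer $l$, an $l$-exchange-ordering is a bijection $\sigma\colon B_1\to B_2$ such that for every $X\subseteq B_1$ with $|X|\le l$ both $(B_1-X)\cup\sigma(X)$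 and $(B_2-\sigma(X))\cup X$ are bases of $M$. The matroid $M$ is $l$-base-orderable if every pair of its bases has an $l$-exchange-ordering, and strongly base-orderable if every pair of its bases has a bijection $\sigma$ satisfying this condition for all $X\subseteq B_1$. Let $l$-$\mathcal{BO}$ and $\mathcal{SBO}$ denote the classes of $l$-base-orderable and of strongly base-orderable matroids. An excluded minor for a class of matroids is a matroid not in the class all of whose proper minors are in the class. A cyclic flat is a flat that is a (possibly empty) union of circuits. Then $M_\beta$ is the unique matroid on $S$ whose cyclic flats are exactly the members of $\mathcal Z$, with ranks given by $r$; it has rank $2k$; and it has the following properties: 1. $M_\beta$ is neither $k$-base-orderable nor strongly base-orderable; 2. every single-element contraction of $M_\beta$ is a transversal matroid; 3. $M_\beta$ is an excluded minor for $\mathcal{SBO}$ and for $k$-$\mathcal{BO}$; 4. $M_\beta$ is $(k-1)$-base-orderable; 5. if $|A|=|B|=|D|=|E|=k/2$, then $M_\beta$ has exactly two unordered pairs of bases that have no $k$-exchange-ordering; otherwise it has exactly one such pair. -/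

import Mathlib

open Matroid

/-! ### Exchange-orderings and base-orderability -/

namespace Matroid

variable {α : Type*}

/-- A `k`-exchange-ordering for a pair of bases `B₁`, `B₂` of `M`: a bijection `σ : B₁ → B₂`
(only the values of `σ` on `B₁` matter) such that for all `X ⊆ B₁` with `|X| ≤ k`, both
`(B₁ - X) ∪ σ(X)` and `(B₂ - σ(X)) ∪ X` are bases. -/
def IsExchangeOrdering (M : Matroid α) (k : ℕ) (B₁ B₂ : Set α) (σ : α → α) : Prop :=
  Set.BijOn σ B₁ B₂ ∧
    ∀ X ⊆ B₁, X.encard ≤ (k : ℕ∞) →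
      M.IsBase ((B₁ \ X) ∪ σ '' X) ∧ M.IsBase ((B₂ \ σ '' X) ∪ X)

/-- `M` is `k`-base-orderable: each pair of its bases has a `k`-exchange-ordering. -/
def KBaseOrderable (k : ℕ) (M : Matroid α) : Prop :=
  ∀ B₁ B₂ : Set α, M.IsBase B₁ → M.IsBase B₂ → ∃ σ : α → α, M.IsExchangeOrdering k B₁ B₂ σ

/-- `M` is strongly base-orderable: for each pair of bases there is a bijection
`σ : B₁ → B₂` such that the two exchange conditions hold for every `X ⊆ B₁`. -/
def StronglyBaseOrderable (M : Matroid α) : Prop :=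
  ∀ B₁ B₂ : Set α, M.IsBase B₁ → M.IsBase B₂ → ∃ σ : α → α, Set.BijOn σ B₁ B₂ ∧
    ∀ X ⊆ B₁, M.IsBase ((B₁ \ X) ∪ σ '' X) ∧ M.IsBase ((B₂ \ σ '' X) ∪ X)

/-- The set of unordered pairs of bases of `M` that have no `k`-exchange-ordering. -/
def pairsWithoutExchangeOrdering (M : Matroid α) (k : ℕ) : Set (Sym2 (Set α)) :=
  {p | ∃ B₁ B₂ : Set α, p = s(B₁, B₂) ∧ M.IsBase B₁ ∧ M.IsBase B₂ ∧
    ¬ ∃ σ : α → α, M.IsExchangeOrdering k B₁ B₂ σ}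

/-- `M` is an excluded minor for the class of matroids satisfying `P`: it is not in the class,
but all its proper minors are. -/
def IsExcludedMinor (P : Matroid α → Prop) (M : Matroid α) : Prop :=
  ¬ P M ∧ ∀ N : Matroid α, N <m M → P N

/-! ### Transversal matroids and cyclic flats -/

/-- `M` is transversal: there is a finite family of subsets of the ground set such that the
independent sets of `M` are exactly the partial transversals of the family. -/
def IsTransversal (M : Matroid α) : Prop :=
  ∃ (n : ℕ) (𝒜 : Fin n → Set α), (∀ j, 𝒜 j ⊆ M.E) ∧
    ∀ I : Set α, M.Indep I ↔
      ∃ φ : I → Fin n, Function.Injective φ ∧ ∀ x : I, (x : α) ∈ 𝒜 (φ x)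

/-- A cyclic flat of `M`: a flat that is a (possibly empty) union of circuits. -/
def IsCyclicFlat (M : Matroid α) (Z : Set α) : Prop :=
  M.IsFlat Z ∧ ∃ 𝒞 : Set (Set α), (∀ C ∈ 𝒞, M.IsCircuit C) ∧ Z = ⋃₀ 𝒞

end Matroid

/-! ### The matroids `M_β` -/

/-- A `6`-tuple `β = (A, B, C, D, E, F)` of pairwise disjoint nonempty finite sets with
`k = |C| = |F| = |A ∪ B| = |D ∪ E|`. -/
structure BetaTuple (α : Type*) [DecidableEq α] (k : ℕ) where
  A : Finset α
  B : Finset α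
  C : Finset α
  D : Finset α
  E : Finset α
  F : Finset α
  nonempty : ∀ S ∈ [A, B, C, D, E, F], S.Nonempty
  disjoint : [A, B, C, D, E, F].Pairwise Disjoint
  card_C : C.card = k
  card_F : F.card = k
  card_AB : (A ∪ B).card = k
  card_DE : (D ∪ E).card = k

namespace BetaTuple

variable {α : Type*} [DecidableEq α] {k : ℕ}

/-- The union of the six sets. -/
def ground (β : BetaTuple α k) : Finset α := β.A ∪ β.B ∪ β.C ∪ β.D ∪ β.E ∪ β.F

/-- The seven members of `𝒵`. -/
def flat (β : BetaTuple α k) : Fin 7 → Finset α :=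
  ![β.ground,
    β.A ∪ β.B ∪ β.D ∪ β.E,
    β.C ∪ β.B ∪ β.E,
    β.C ∪ β.A ∪ β.D,
    β.F ∪ β.E ∪ β.A,
    β.F ∪ β.D ∪ β.B,
    ∅]

/-- The ranks prescribed on the seven members of `𝒵`, in the same order. -/
def rank (β : BetaTuple α k) : Fin 7 → ℕ :=
  ![2 * k,
    2 * k - 1,
    k + β.B.card,
    k + β.A.card,
    k + β.E.card,
    k + β.D.card,
    0]

theorem inter_card_add_le (β : BetaTuple α k) {i j : Fin 7} (hi0 : i ≠ 0) (hi6 : i ≠ 6)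
    (hij : i < j) (hj6 : j ≠ 6) :
    (β.flat i ∩ β.flat j).card + 2 * k ≤ β.rank i + β.rank j := by
  have hd := β.disjoint
  have hn := β.nonempty
  simp only [List.pairwise_cons, List.mem_cons, List.not_mem_nil, or_false, forall_eq_or_imp,
    forall_eq, List.Pairwise.nil, and_true, Finset.disjoint_left, false_imp_iff,
    implies_true] at hd hn
  obtain ⟨hAp, hBp, hCp, hDp, hEp, hFp⟩ := hn
  rw [← Finset.card_pos] at hAp hBp hCp hDp hEp hFp
  have hAB : β.A.card + β.B.card = k := by
    rw [← Finset.card_union_of_disjoint (Finset.disjoint_left.2 fun _ h ↦ hd.1.1 h)]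
    exact β.card_AB
  have hDE : β.D.card + β.E.card = k := by
    rw [← Finset.card_union_of_disjoint
      (Finset.disjoint_left.2 fun _ h ↦ hd.2.2.2.1.1 h)]
    exact β.card_DE
  have hC := β.card_C
  have hF := β.card_F
  have key : ∀ (Z X Y : Finset α), Z ⊆ X ∪ Y → Z.card ≤ X.card + Y.card := fun Z X Y h ↦
    (Finset.card_le_card h).trans (Finset.card_union_le X Y)
  have h1 : ((β.A ∪ β.B ∪ β.D ∪ β.E) ∩ (β.C ∪ β.B ∪ β.E)).card ≤ β.B.card + β.E.card :=
    key _ _ _ (by intro x; simp only [Finset.mem_inter, Finset.mem_union]; grind)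
  have h2 : ((β.A ∪ β.B ∪ β.D ∪ β.E) ∩ (β.C ∪ β.A ∪ β.D)).card ≤ β.A.card + β.D.card :=
    key _ _ _ (by intro x; simp only [Finset.mem_inter, Finset.mem_union]; grind)
  have h3 : ((β.A ∪ β.B ∪ β.D ∪ β.E) ∩ (β.F ∪ β.E ∪ β.A)).card ≤ β.E.card + β.A.card :=
    key _ _ _ (by intro x; simp only [Finset.mem_inter, Finset.mem_union]; grind)
  have h4 : ((β.A ∪ β.B ∪ β.D ∪ β.E) ∩ (β.F ∪ β.D ∪ β.B)).card ≤ β.D.card + β.B.card :=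
    key _ _ _ (by intro x; simp only [Finset.mem_inter, Finset.mem_union]; grind)
  have h5 : ((β.C ∪ β.B ∪ β.E) ∩ (β.C ∪ β.A ∪ β.D)).card ≤ β.C.card :=
    Finset.card_le_card (by intro x; simp only [Finset.mem_inter, Finset.mem_union]; grind)
  have h6 : ((β.C ∪ β.B ∪ β.E) ∩ (β.F ∪ β.E ∪ β.A)).card ≤ β.E.card :=
    Finset.card_le_card (by intro x; simp only [Finset.mem_inter, Finset.mem_union]; grind)
  have h7 : ((β.C ∪ β.B ∪ β.E) ∩ (β.F ∪ β.D ∪ β.B)).card ≤ β.B.card :=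
    Finset.card_le_card (by intro x; simp only [Finset.mem_inter, Finset.mem_union]; grind)
  have h8 : ((β.C ∪ β.A ∪ β.D) ∩ (β.F ∪ β.E ∪ β.A)).card ≤ β.A.card :=
    Finset.card_le_card (by intro x; simp only [Finset.mem_inter, Finset.mem_union]; grind)
  have h9 : ((β.C ∪ β.A ∪ β.D) ∩ (β.F ∪ β.D ∪ β.B)).card ≤ β.D.card :=
    Finset.card_le_card (by intro x; simp only [Finset.mem_inter, Finset.mem_union]; grind)
  have h10 : ((β.F ∪ β.E ∪ β.A) ∩ (β.F ∪ β.D ∪ β.B)).card ≤ β.F.card :=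
    Finset.card_le_card (by intro x; simp only [Finset.mem_inter, Finset.mem_union]; grind)
  fin_cases i <;> fin_cases j <;> simp [flat, rank, -Finset.union_assoc] at hi0 hi6 hij hj6 ⊢ <;> omega

/-- If `|I ∩ Z| = r(Z)` for two different nonempty members `Z` of `𝒵`, then `|I| ≥ 2k`. -/
theorem two_mul_le_card_of_tight (β : BetaTuple α k) {I : Finset α} {i j : Fin 7}
    (hij : i ≠ j) (hi6 : i ≠ 6) (hj6 : j ≠ 6) (hi : (I ∩ β.flat i).card = β.rank i)
    (hj : (I ∩ β.flat j).card = β.rank j) : 2 * k ≤ I.card := by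
  wlog hlt : i < j generalizing i j
  · exact this hij.symm hj6 hi6 hj hi (lt_of_le_of_ne (not_lt.1 hlt) hij.symm)
  by_cases hi0 : i = 0
  · subst hi0
    have h0 : β.rank 0 = 2 * k := rfl
    rw [← h0, ← hi]
    exact Finset.card_le_card Finset.inter_subset_left
  have h1 := β.inter_card_add_le hi0 hi6 hlt hj6
  have h2 := Finset.card_union_add_card_inter (I ∩ β.flat i) (I ∩ β.flat j)
  have h3 : ((I ∩ β.flat i) ∪ (I ∩ β.flat j)).card ≤ I.card :=
    Finset.card_le_card (Finset.union_subset Finset.inter_subset_left Finset.inter_subset_left)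
  have h4 : ((I ∩ β.flat i) ∩ (I ∩ β.flat j)).card ≤ (β.flat i ∩ β.flat j).card :=
    Finset.card_le_card
      (Finset.inter_subset_inter Finset.inter_subset_right Finset.inter_subset_right)
  omega

/-- The augmentation property for the sets `I` with `|I ∩ Z| ≤ r(Z)` for all `Z ∈ 𝒵`. -/
theorem exists_augment (β : BetaTuple α k) {I J : Finset α} (hJE : J ⊆ β.ground)
    (hI : ∀ i, (I ∩ β.flat i).card ≤ β.rank i) (hJ : ∀ i, (J ∩ β.flat i).card ≤ β.rank i)
    (hIJ : I.card < J.card) :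
    ∃ e ∈ J, e ∉ I ∧ ∀ i, (insert e I ∩ β.flat i).card ≤ β.rank i := by
  by_contra! hcon
  have hJ2 : J.card ≤ 2 * k := by
    have h := hJ 0
    have h0 : β.flat 0 = β.ground := rfl
    rw [h0, Finset.inter_eq_left.2 hJE] at h
    exact h
  have tight : ∀ e ∈ J, e ∉ I → ∃ i, i ≠ 6 ∧ e ∈ β.flat i ∧ (I ∩ β.flat i).card = β.rank i := by
    intro e heJ heI
    obtain ⟨i, hi⟩ := hcon e heJ heI
    have he : e ∈ β.flat i := by
      by_contra he
      rw [Finset.insert_inter_of_notMem he] at hi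
      exact absurd (hI i) (not_le.2 hi)
    refine ⟨i, ?_, he, ?_⟩
    · rintro rfl
      exact absurd he (Finset.notMem_empty e)
    · rw [Finset.insert_inter_of_mem he] at hi
      have := Finset.card_insert_le e (I ∩ β.flat i)
      have := hI i
      omega
  obtain ⟨e, heJ, heI⟩ := Finset.exists_mem_notMem_of_card_lt_card hIJ
  obtain ⟨i, hi6, -, hi⟩ := tight e heJ heI
  have hsub : J \ β.flat i ⊆ I \ β.flat i := by
    intro f hf
    rw [Finset.mem_sdiff] at hf ⊢
    refine ⟨?_, hf.2⟩
    by_contra hfI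
    obtain ⟨j, hj6, hfj, hj⟩ := tight f hf.1 hfI
    have hij : i ≠ j := by
      rintro rfl
      exact hf.2 hfj
    have := β.two_mul_le_card_of_tight hij hi6 hj6 hi hj
    omega
  have h1 := Finset.card_le_card hsub
  have h2 := Finset.card_inter_add_card_sdiff J (β.flat i)
  have h3 := Finset.card_inter_add_card_sdiff I (β.flat i)
  have h4 := hJ i
  omega

/-- The matroid `M_β` on the union of the six sets with rank function
`X ↦ min {r(Z) + |X - Z| : Z ∈ 𝒵}`; equivalently, `I` is independent if and only if
`|I ∩ Z| ≤ r(Z)` for all `Z ∈ 𝒵`. -/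
def matroid (β : BetaTuple α k) : Matroid α :=
  (IndepMatroid.ofFinite (E := (β.ground : Set α)) β.ground.finite_toSet
    (fun I ↦ I ⊆ β.ground ∧ ∀ i, (I ∩ (β.flat i : Set α)).encard ≤ (β.rank i : ℕ∞))
    (by simp)
    (fun I J hJ hIJ ↦ ⟨hIJ.trans hJ.1, fun i ↦
      (Set.encard_le_encard (Set.inter_subset_inter_left _ hIJ)).trans (hJ.2 i)⟩)
    (by
      intro I J hI hJ hlt
      lift I to Finset α using β.ground.finite_toSet.subset hI.1
      lift J to Finset α using β.ground.finite_toSet.subset hJ.1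
      have key := β.exists_augment (I := I) (J := J) (by exact_mod_cast hJ.1)
        (fun i ↦ by
          have := hI.2 i
          rw [← Finset.coe_inter, Set.encard_coe_eq_coe_finsetCard] at this
          exact_mod_cast this)
        (fun i ↦ by
          have := hJ.2 i
          rw [← Finset.coe_inter, Set.encard_coe_eq_coe_finsetCard] at this
          exact_mod_cast this)
        (by simpa using hlt)
      obtain ⟨e, heJ, heI, he⟩ := key
      refine ⟨e, by exact_mod_cast heJ, by exact_mod_cast heI, ?_, fun i ↦ ?_⟩
      · exact Set.insert_subset (hJ.1 (by exact_mod_cast heJ)) hI.1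
      · rw [← Finset.coe_insert, ← Finset.coe_inter, Set.encard_coe_eq_coe_finsetCard]
        exact_mod_cast he i)
    (fun I hI ↦ hI.1)).matroid

theorem matroid_ground (β : BetaTuple α k) : β.matroid.E = (β.ground : Set α) := rfl

theorem matroid_indep_iff (β : BetaTuple α k) {I : Set α} :
    β.matroid.Indep I ↔
      I ⊆ β.ground ∧ ∀ i, (I ∩ (β.flat i : Set α)).encard ≤ (β.rank i : ℕ∞) := Iff.rfl

end BetaTuple

/-! ### Serial symmetric exchange between two sets -/

/-- There is a bijection from `B₁ \ B₂` to `B₂ \ B₁` along which any part of `B₁` can be exchanged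
without leaving the family `P`. -/
def SwapPair {α : Type*} (P : Set α → Prop) (B₁ B₂ : Set α) : Prop :=
  ∃ σ : α → α, Set.BijOn σ (B₁ \ B₂) (B₂ \ B₁) ∧ ∀ X ⊆ B₁ \ B₂, P ((B₁ \ X) ∪ σ '' X)

namespace SwapPair

variable {α : Type*} {P Q : Set α → Prop} {B₁ B₂ : Set α}

theorem exists_inverse {σ : α → α} {s t : Set α} (hσ : Set.BijOn σ s t) :
    ∃ τ : α → α, Set.BijOn τ t s ∧ Set.InvOn τ σ s t := by
  rcases s.eq_empty_or_nonempty with rfl | ⟨x, hx⟩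
  · have ht : t = ∅ := by simpa using hσ.image_eq.symm
    subst ht
    exact ⟨id, Set.bijOn_empty _, by simp [Set.InvOn, Set.LeftInvOn, Set.RightInvOn]⟩
  · have : Nonempty α := ⟨x⟩
    have h := hσ.invOn_invFunOn
    exact ⟨Function.invFunOn σ s, hσ.symm h.symm, h⟩

/-- Exchanging a set backwards gives the same result as exchanging the complement of its partner
forwards. -/
theorem symm (h : SwapPair P B₁ B₂) : SwapPair P B₂ B₁ := by
  obtain ⟨σ, hσ, h⟩ := h
  obtain ⟨τ, hτ, hinv⟩ := exists_inverse hσ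
  refine ⟨τ, hτ, fun X hX ↦ ?_⟩
  have hY : τ '' X ⊆ B₁ \ B₂ := (Set.image_mono hX).trans hτ.image_eq.subset
  convert h ((B₁ \ B₂) \ τ '' X) Set.sdiff_subset using 1
  have him : σ '' ((B₁ \ B₂) \ τ '' X) = (B₂ \ B₁) \ X := by
    rw [hσ.injOn.image_sdiff_subset hY, hσ.image_eq, Set.image_image,
      Set.image_congr (fun x hx ↦ hinv.2 (hX hx)), Set.image_id']
  rw [him]
  ext z
  have h1 := @hX z
  have h2 := @hY z
  simp only [Set.mem_sdiff, Set.mem_union] at *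
  tauto

/-- A bijection from `B₁` to `B₂` along which the exchanges are possible as long as the result has
the right size can be straightened to fix `B₁ ∩ B₂`. -/
theorem of_bijOn (hfin : B₁.Finite) (f : α → α) (hf : Set.BijOn f B₁ B₂)
    (hP : ∀ X ⊆ B₁, Disjoint (f '' X) (B₁ \ X) → P ((B₁ \ X) ∪ f '' X)) : SwapPair P B₁ B₂ := by
  classical
  induction hn : {y ∈ B₁ ∩ B₂ | f y ≠ y}.ncard using Nat.strong_induction_on generalizing f with
  | _ n ih =>
  by_cases hfix : ∀ y ∈ B₁ ∩ B₂, f y = y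
  · have hsub : Set.BijOn f (B₁ \ B₂) (B₂ \ B₁) := by
      refine ⟨fun x hx ↦ ⟨hf.mapsTo hx.1, fun hx1 ↦ ?_⟩, hf.injOn.mono Set.sdiff_subset,
        fun y hy ↦ ?_⟩
      · have := hf.injOn hx1 hx.1 (hfix _ ⟨hx1, hf.mapsTo hx.1⟩)
        exact hx.2 (this ▸ hf.mapsTo hx.1)
      · obtain ⟨x, hx, rfl⟩ := hf.surjOn hy.1
        exact ⟨x, ⟨hx, fun hx2 ↦ hy.2 (by rwa [hfix x ⟨hx, hx2⟩])⟩, rfl⟩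
    refine ⟨f, hsub, fun X hX ↦ hP X (hX.trans Set.sdiff_subset) ?_⟩
    refine Set.disjoint_left.2 ?_
    rintro _ ⟨x, hx, rfl⟩ h
    exact (hsub.mapsTo (hX hx)).2 h.1
  · push Not at hfix
    obtain ⟨y, hy, hne⟩ := hfix
    obtain ⟨x, hx, hxy⟩ := hf.surjOn hy.2
    -- Composing with the transposition of `x` and `y` makes the common element `y` a fixed point
    -- and unfixes none, so the number of moved common elements drops.
    have hxne : x ≠ y := by rintro rfl; exact hne hxy
    have hsw : ∀ X : Set α, (x ∈ X ↔ y ∈ X) → Equiv.swap x y '' X = X := by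
      intro X hX
      ext z
      rw [Equiv.image_eq_preimage_symm, Set.mem_preimage, Equiv.symm_swap]
      rcases eq_or_ne z x with rfl | hzx
      · rw [Equiv.swap_apply_left, hX]
      rcases eq_or_ne z y with rfl | hzy
      · rw [Equiv.swap_apply_right, hX]
      rw [Equiv.swap_apply_of_ne_of_ne hzx hzy]
    have hswB : Set.BijOn (Equiv.swap x y) B₁ B₁ := by
      have := (Equiv.swap x y).injective.injOn.bijOn_image (s := B₁)
      rwa [hsw B₁ (by simp [hx, hy.1])] at this
    have him : ∀ X : Set α, (x ∈ X ↔ y ∈ X) → (f ∘ Equiv.swap x y) '' X = f '' X := by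
      intro X hX
      rw [Set.image_comp, hsw X hX]
    have hgy : (f ∘ Equiv.swap x y) y = y := by simp [hxy]
    have hg := hf.comp hswB
    refine ih _ ?_ (f ∘ Equiv.swap x y) hg ?_ rfl
    · rw [← hn]
      refine Set.ncard_lt_ncard ?_ ((hfin.inter_of_left B₂).subset (Set.sep_subset _ _))
      refine ⟨fun z hz ↦ ⟨hz.1, fun hfz ↦ hz.2 ?_⟩, fun hsub ↦ (hsub ⟨hy, hne⟩).2 hgy⟩
      have hzy : z ≠ y := by rintro rfl; exact hne hfz
      have hzx : z ≠ x := by rintro rfl; exact hxne (hfz.symm.trans hxy)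
      simpa [Equiv.swap_apply_of_ne_of_ne hzx hzy] using hfz
    · intro X hX hdis
      -- Once `y` is fixed, adding it to `X` or removing it does not change the exchanged set. So
      -- `X` may be assumed to contain both of `x`, `y` or neither, and then both bijections have
      -- the same image.
      by_cases hxX : x ∈ X
      · have h1 := him (insert y X) (by simp [hxX])
        have h2 : (B₁ \ insert y X) ∪ f '' insert y X = (B₁ \ X) ∪ (f ∘ Equiv.swap x y) '' X := by
          rw [← h1, Set.image_insert_eq, hgy]
          ext z
          have h3 : y ∈ X → y ∈ (f ∘ Equiv.swap x y) '' X := fun h ↦ ⟨y, h, hgy⟩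
          have h4 := hy.1
          simp only [Set.mem_sdiff, Set.mem_union, Set.mem_insert_iff]
          by_cases hz : z = y
          · subst hz; tauto
          · tauto
        rw [← h2]
        refine hP _ (Set.insert_subset hy.1 hX) ?_
        rw [← h1, Set.image_insert_eq, hgy, Set.disjoint_left]
        intro z hz hz2
        rw [Set.disjoint_left] at hdis
        rcases hz with rfl | hz
        · exact hz2.2 (Set.mem_insert _ _)
        · exact hdis hz ⟨hz2.1, fun h ↦ hz2.2 (Set.mem_insert_of_mem _ h)⟩
      · have h1 := him (X \ {y}) (by simp [hxX])
        have h0 : ∀ z, z ∈ (f ∘ Equiv.swap x y) '' X → z ≠ y →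
            z ∈ (f ∘ Equiv.swap x y) '' (X \ {y}) := by
          rintro _ ⟨w, hw, rfl⟩ hne'
          exact ⟨w, ⟨hw, fun h ↦ hne' (by rw [Set.mem_singleton_iff.1 h, hgy])⟩, rfl⟩
        have h0' : (f ∘ Equiv.swap x y) '' (X \ {y}) ⊆ (f ∘ Equiv.swap x y) '' X :=
          Set.image_mono Set.sdiff_subset
        have h2 : (B₁ \ (X \ {y})) ∪ f '' (X \ {y}) = (B₁ \ X) ∪ (f ∘ Equiv.swap x y) '' X := by
          rw [← h1]
          ext z
          have h3 : y ∈ X → y ∈ (f ∘ Equiv.swap x y) '' X := fun h ↦ ⟨y, h, hgy⟩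
          have h4 := hy.1
          have h5 := h0 z
          have h6 := @h0' z
          simp only [Set.mem_sdiff, Set.mem_union, Set.mem_singleton_iff]
          by_cases hz : z = y
          · subst hz; tauto
          · tauto
        rw [← h2]
        refine hP _ (Set.sdiff_subset.trans hX) ?_
        rw [← h1, Set.disjoint_left]
        intro z hz hz2
        by_cases hzy : z = y
        · obtain ⟨w, hw, hwz⟩ := hz
          have := hg.injOn (hX hw.1) hy.1 (hwz.trans (hzy.trans hgy.symm))
          exact hw.2 this
        · exact Set.disjoint_left.1 hdis (h0' hz) ⟨hz2.1, fun h ↦ hz2.2 ⟨h, hzy⟩⟩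

end SwapPair

/-- `B` is a full transversal of the family `W`, with one element for each index. -/
def IsFullTransversal {α ι : Type*} (W : ι → Set α) (B : Set α) : Prop :=
  ∃ φ : α → ι, Set.BijOn φ B Set.univ ∧ ∀ x ∈ B, x ∈ W (φ x)

/-- Each element of `B₁` is sent to the element of `B₂` that represents the same index. Every
exchange keeps exactly one representative per index. Common elements may represent different indices
in the two transversals, which is why the bijection is straightened by `SwapPair.of_bijOn`. -/
theorem IsFullTransversal.swapPair {α ι : Type*} {W : ι → Set α} {B₁ B₂ : Set α}
    (hfin : B₁.Finite) (h₁ : IsFullTransversal W B₁) (h₂ : IsFullTransversal W B₂) :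
    SwapPair (IsFullTransversal W) B₁ B₂ := by
  classical
  obtain ⟨φ, hφ, hφW⟩ := h₁
  obtain ⟨ψ, hψ, hψW⟩ := h₂
  have key : ∃ f : α → α, Set.BijOn f B₁ B₂ ∧ ∀ x ∈ B₁, ψ (f x) = φ x := by
    have : ∀ x, ∃ y, x ∈ B₁ → y ∈ B₂ ∧ ψ y = φ x := by
      intro x
      by_cases hx : x ∈ B₁
      · obtain ⟨y, hy, hyx⟩ := hψ.surjOn (Set.mem_univ (φ x))
        exact ⟨y, fun _ ↦ ⟨hy, hyx⟩⟩
      · exact ⟨x, fun h ↦ absurd h hx⟩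
    choose f hf using this
    refine ⟨f, ⟨fun x hx ↦ (hf x hx).1, fun x hx y hy hxy ↦ ?_, fun y hy ↦ ?_⟩,
      fun x hx ↦ (hf x hx).2⟩
    · exact hφ.injOn hx hy (by rw [← (hf x hx).2, ← (hf y hy).2, hxy])
    · obtain ⟨x, hx, hxy⟩ := hφ.surjOn (Set.mem_univ (ψ y))
      exact ⟨x, hx, hψ.injOn (hf x hx).1 hy ((hf x hx).2.trans hxy)⟩
  obtain ⟨f, hf, hfφ⟩ := key
  refine SwapPair.of_bijOn hfin f hf fun X hX hdis ↦ ?_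
  have hn : ∀ z ∈ B₁ \ X, z ∉ f '' X := fun z hz h ↦ Set.disjoint_left.1 hdis h hz
  refine ⟨fun z ↦ if z ∈ f '' X then ψ z else φ z, ⟨fun _ _ ↦ Set.mem_univ _, ?_, ?_⟩, ?_⟩
  · rintro x (hx | hx) y (hy | hy) hxy
    · simp only [hn x hx, hn y hy, if_false] at hxy
      exact hφ.injOn hx.1 hy.1 hxy
    · simp only [hn x hx, hy, if_false, if_true] at hxy
      obtain ⟨w, hw, rfl⟩ := hy
      rw [hfφ w (hX hw)] at hxy
      have := hφ.injOn hx.1 (hX hw) hxy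
      exact absurd (this ▸ hw) hx.2
    · simp only [hn y hy, hx, if_false, if_true] at hxy
      obtain ⟨w, hw, rfl⟩ := hx
      rw [hfφ w (hX hw)] at hxy
      have := hφ.injOn (hX hw) hy.1 hxy
      exact absurd (this ▸ hw) hy.2
    · simp only [hx, hy, if_true] at hxy
      obtain ⟨v, hv, rfl⟩ := hx
      obtain ⟨w, hw, rfl⟩ := hy
      rw [hfφ w (hX hw), hfφ v (hX hv)] at hxy
      rw [hφ.injOn (hX hv) (hX hw) hxy]
  · intro i _
    obtain ⟨x, hx, rfl⟩ := hφ.surjOn (Set.mem_univ i)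
    by_cases hxX : x ∈ X
    · exact ⟨f x, Or.inr ⟨x, hxX, rfl⟩, by simp only [Set.mem_image_of_mem f hxX, if_true, hfφ x hx]⟩
    · exact ⟨x, Or.inl ⟨hx, hxX⟩, by simp only [hn x ⟨hx, hxX⟩, if_false]⟩
  · rintro x (hx | hx)
    · simpa only [hn x hx, if_false] using hφW x hx.1
    · simp only [hx, if_true]
      obtain ⟨w, hw, rfl⟩ := hx
      exact hψW _ (hf.mapsTo (hX hw))

/-! ### Orderability from exchange bijections, and closure under minors -/

namespace Matroid

variable {α : Type*} {M : Matroid α} {B₁ B₂ : Set α}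

theorem exists_exchange_of_swapPair (h : SwapPair M.IsBase B₁ B₂) :
    ∃ σ : α → α, Set.BijOn σ B₁ B₂ ∧
      ∀ X ⊆ B₁, M.IsBase ((B₁ \ X) ∪ σ '' X) ∧ M.IsBase ((B₂ \ σ '' X) ∪ X) := by
  classical
  obtain ⟨σ, hσ, h⟩ := h
  let τ : α → α := fun x ↦ if x ∈ B₂ then x else σ x
  have hτ₁ : ∀ x ∈ B₂, τ x = x := fun x hx ↦ if_pos hx
  have hτ₂ : ∀ x ∉ B₂, τ x = σ x := fun x hx ↦ if_neg hx
  have hτ : Set.BijOn τ B₁ B₂ := by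
    have hb1 : Set.BijOn τ (B₁ \ B₂) (B₂ \ B₁) := hσ.congr fun x hx ↦ (hτ₂ x hx.2).symm
    have hb2 : Set.BijOn τ (B₁ ∩ B₂) (B₁ ∩ B₂) :=
      (Set.bijOn_id _).congr fun x hx ↦ (hτ₁ x hx.2).symm
    have := hb1.union hb2 ?_
    · rwa [Set.sdiff_union_inter, Set.inter_comm, Set.sdiff_union_inter] at this
    rintro x (hx | hx) y (hy | hy) hxy
    · exact hb1.injOn hx hy hxy
    · exact absurd (hxy ▸ hb2.mapsTo hy).1 (hb1.mapsTo hx).2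
    · exact absurd (hxy ▸ hb2.mapsTo hx).1 (hb1.mapsTo hy).2
    · exact hb2.injOn hx hy hxy
  have key : ∀ X ⊆ B₁, M.IsBase ((B₁ \ X) ∪ τ '' X) := by
    intro X hX
    convert h (X \ B₂) (Set.sdiff_subset_sdiff_left hX) using 1
    have : τ '' X = σ '' (X \ B₂) ∪ (X ∩ B₂) := by
      conv_lhs => rw [← Set.sdiff_union_inter X B₂]
      rw [Set.image_union]
      congr 1
      · exact Set.image_congr fun x hx ↦ hτ₂ x hx.2
      · rw [Set.image_congr (fun x hx ↦ hτ₁ x hx.2), Set.image_id']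
    rw [this]
    ext z
    have := @hX z
    simp only [Set.mem_union, Set.mem_sdiff, Set.mem_inter_iff]
    tauto
  refine ⟨τ, hτ, fun X hX ↦ ⟨key X hX, ?_⟩⟩
  -- The second exchange condition for `X` is the first one for the complement of `X` in `B₁`.
  have := key (B₁ \ X) Set.sdiff_subset
  rwa [hτ.injOn.image_sdiff_subset hX, hτ.image_eq, Set.sdiff_sdiff_cancel_left hX,
    Set.union_comm] at this

theorem exists_isExchangeOrdering_of_swapPair (k : ℕ) (h : SwapPair M.IsBase B₁ B₂) :
    ∃ σ : α → α, M.IsExchangeOrdering k B₁ B₂ σ := by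
  obtain ⟨σ, hσ, h⟩ := exists_exchange_of_swapPair h
  exact ⟨σ, hσ, fun X hX _ ↦ h X hX⟩

theorem swapPair_dual (h : SwapPair M.IsBase B₁ B₂) (h₁ : B₁ ⊆ M.E) (h₂ : B₂ ⊆ M.E) :
    SwapPair M✶.IsBase (M.E \ B₁) (M.E \ B₂) := by
  obtain ⟨σ, hσ, h⟩ := h.symm
  have e1 : (M.E \ B₁) \ (M.E \ B₂) = B₂ \ B₁ := by
    ext z; have := @h₁ z; have := @h₂ z; simp only [Set.mem_sdiff]; tauto
  have e2 : (M.E \ B₂) \ (M.E \ B₁) = B₁ \ B₂ := by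
    ext z; have := @h₁ z; have := @h₂ z; simp only [Set.mem_sdiff]; tauto
  refine ⟨σ, by rwa [e1, e2], fun X hX ↦ ?_⟩
  rw [e1] at hX
  have hY : σ '' X ⊆ B₁ \ B₂ := (Set.image_mono hX).trans hσ.image_eq.subset
  have hsub : (M.E \ B₁) \ X ∪ σ '' X ⊆ M.E :=
    Set.union_subset (Set.sdiff_subset.trans Set.sdiff_subset)
      (hY.trans (Set.sdiff_subset.trans h₁))
  rw [dual_isBase_iff]
  convert h ((B₂ \ B₁) \ X) Set.sdiff_subset using 1
  rw [hσ.injOn.image_sdiff_subset hX, hσ.image_eq]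
  ext z
  have := @h₁ z; have := @h₂ z; have := @hX z; have := @hY z
  simp only [Set.mem_sdiff, Set.mem_union] at *
  tauto

/-- Each pair of bases has an exchange bijection that fixes the common elements. -/
def AllSwap (M : Matroid α) : Prop :=
  ∀ B₁ B₂ : Set α, M.IsBase B₁ → M.IsBase B₂ → SwapPair M.IsBase B₁ B₂

theorem AllSwap.stronglyBaseOrderable (h : M.AllSwap) : M.StronglyBaseOrderable :=
  fun B₁ B₂ h₁ h₂ ↦ exists_exchange_of_swapPair (h B₁ B₂ h₁ h₂)

theorem AllSwap.kBaseOrderable (h : M.AllSwap) (k : ℕ) : M.KBaseOrderable k :=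
  fun B₁ B₂ h₁ h₂ ↦ exists_isExchangeOrdering_of_swapPair k (h B₁ B₂ h₁ h₂)

theorem AllSwap.dual (h : M.AllSwap) : M✶.AllSwap := by
  intro B₁ B₂ h₁ h₂
  have := swapPair_dual (h _ _ h₁.compl_isBase_of_dual h₂.compl_isBase_of_dual)
    Set.sdiff_subset Set.sdiff_subset
  rwa [Set.sdiff_sdiff_cancel_left (show B₁ ⊆ M.E from h₁.subset_ground),
    Set.sdiff_sdiff_cancel_left (show B₂ ⊆ M.E from h₂.subset_ground)] at this

/-- Two bases of the deletion extend to bases of `M` by the same set `K`. An exchange that fixes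
common elements never moves `K`, so it restricts to the deletion. -/
theorem AllSwap.delete [M.Finite] (h : M.AllSwap) (D : Set α) : (M ＼ D).AllSwap := by
  intro I₁ I₂ h₁ h₂
  rw [delete_isBase_iff] at h₁ h₂
  obtain ⟨B₁, hB₁, hI₁⟩ := h₁.exists_isBase
  obtain ⟨B₂, hB₂, hI₂B, hB₂I⟩ := h₂.indep.exists_isBase_subset_union_isBase hB₁
  set K := B₁ \ (M.E \ D) with hKdef
  have hK₁ : B₁ = I₁ ∪ K := by rw [hI₁, Set.inter_union_sdiff]
  have hKd : ∀ J ⊆ M.E \ D, Disjoint J K := fun J hJ ↦ Set.disjoint_left.2 fun x hx hxK ↦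
    hxK.2 (hJ hx)
  have hB₂sub : B₂ ⊆ I₂ ∪ K := by
    intro x hx
    by_cases hxR : x ∈ M.E \ D
    · left
      have : B₂ ∩ (M.E \ D) = I₂ := (h₂.eq_of_subset_indep (hB₂.indep.inter_right _)
        (Set.subset_inter hI₂B h₂.subset) Set.inter_subset_right).symm
      exact this ▸ ⟨hx, hxR⟩
    · rcases hB₂I hx with h | h
      · exact Or.inl h
      · exact Or.inr ⟨h, hxR⟩
  have hK₂ : B₂ = I₂ ∪ K := by
    refine (M.set_finite B₂ hB₂.subset_ground).eq_of_subset_of_encard_le hB₂sub ?_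
    rw [hB₂.encard_eq_encard_of_isBase hB₁, hK₁, Set.encard_union_eq (hKd _ h₁.subset),
      Set.encard_union_eq (hKd _ h₂.subset), h₁.encard_eq_encard h₂]
  obtain ⟨σ, hσ, hex⟩ := h B₁ B₂ hB₁ hB₂
  have e1 : B₁ \ B₂ = I₁ \ I₂ := by
    have h3 := Set.disjoint_left.1 (hKd _ h₁.subset)
    ext x; have := @h3 x; simp only [hK₁, hK₂, Set.mem_sdiff, Set.mem_union]; tauto
  have e2 : B₂ \ B₁ = I₂ \ I₁ := by
    have h3 := Set.disjoint_left.1 (hKd _ h₂.subset)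
    ext x; have := @h3 x; simp only [hK₁, hK₂, Set.mem_sdiff, Set.mem_union]; tauto
  rw [e1, e2] at hσ
  rw [e1] at hex
  refine ⟨σ, hσ, fun X hX ↦ ?_⟩
  have hY : σ '' X ⊆ I₂ \ I₁ := (Set.image_mono hX).trans hσ.image_eq.subset
  have hJR : (I₁ \ X) ∪ σ '' X ⊆ M.E \ D := Set.union_subset (Set.sdiff_subset.trans h₁.subset)
    (hY.trans (Set.sdiff_subset.trans h₂.subset))
  have hJ : M.Indep ((I₁ \ X) ∪ σ '' X) :=
    (hex X hX).indep.subset (Set.union_subset_union_left _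
      (Set.sdiff_subset_sdiff_left (hK₁ ▸ Set.subset_union_left)))
  obtain ⟨J', hJ', hJJ'⟩ := hJ.subset_isBasis_of_subset hJR Set.sdiff_subset
  rw [delete_isBase_iff]
  suffices (I₁ \ X) ∪ σ '' X = J' by rwa [this]
  refine (M.set_finite _ hJ.subset_ground).eq_of_subset_of_encard_le hJJ' ?_
  rw [hJ'.encard_eq_encard h₁, Set.encard_union_eq, (hσ.injOn.mono hX).encard_image,
    Set.encard_sdiff_add_encard_of_subset (hX.trans Set.sdiff_subset)]
  exact Set.disjoint_left.2 fun x hx hx2 ↦ (hY hx2).2 hx.1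

theorem AllSwap.contract [M.Finite] (h : M.AllSwap) (C : Set α) : (M ／ C).AllSwap := by
  have := (h.dual.delete C).dual
  rwa [dual_delete_dual] at this

/-- A proper minor loses some element `x`. As deletion and contraction commute, `x` can be removed
first, and the rest follows from closure under minors. -/
theorem allSwap_of_isStrictMinor [M.Finite] {N : Matroid α} (hN : N <m M)
    (hdel : ∀ x ∈ M.E, (M ＼ {x}).AllSwap) (hcon : ∀ x ∈ M.E, (M ／ {x}).AllSwap) :
    N.AllSwap := by
  have hne := hN.ssubset
  obtain ⟨C, D, rfl⟩ := hN.isMinor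
  obtain ⟨x, hxM, hx⟩ := Set.exists_of_ssubset hne
  by_cases hxC : x ∈ C
  · have : M ／ C = M ／ {x} ／ (C \ {x}) := by
      rw [contract_contract, Set.union_sdiff_cancel (Set.singleton_subset_iff.2 hxC)]
    rw [this]
    have hf : (M ／ {x}).Finite := ⟨M.ground_finite.subset Set.sdiff_subset⟩
    have hf' : (M ／ {x} ／ (C \ {x})).Finite := ⟨(M ／ {x}).ground_finite.subset Set.sdiff_subset⟩
    exact ((hcon x hxM).contract _).delete D
  · have hxD : x ∈ D := by
      by_contra hxD
      exact hx ⟨⟨hxM, hxC⟩, hxD⟩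
    rw [contract_delete_comm']
    have hxD' : x ∈ D \ C := ⟨hxD, hxC⟩
    have : M ＼ (D \ C) = M ＼ {x} ＼ ((D \ C) \ {x}) := by
      rw [delete_delete, Set.union_sdiff_cancel (Set.singleton_subset_iff.2 hxD')]
    rw [this]
    have hf : (M ＼ {x}).Finite := ⟨M.ground_finite.subset Set.sdiff_subset⟩
    have hf' : (M ＼ {x} ＼ ((D \ C) \ {x})).Finite :=
      ⟨(M ＼ {x}).ground_finite.subset Set.sdiff_subset⟩
    exact ((hdel x hxM).delete _).contract C

theorem isExcludedMinor_of_allSwap [M.Finite] {P : Matroid α → Prop} (hM : ¬ P M)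
    (hP : ∀ N : Matroid α, N.AllSwap → P N)
    (hdel : ∀ x ∈ M.E, (M ＼ {x}).AllSwap) (hcon : ∀ x ∈ M.E, (M ／ {x}).AllSwap) :
    M.IsExcludedMinor P :=
  ⟨hM, fun _ hN ↦ hP _ (allSwap_of_isStrictMinor hN hdel hcon)⟩

end Matroid

/-! ### Full transversals of families with multiplicities -/

section Hall

variable {α κ : Type*} [DecidableEq α] [DecidableEq κ]

/-- The family in which the set `W i` occurs `n i` times. -/
def repeatedFamily (n : κ → ℕ) (W : κ → Finset α) (p : Σ i, Fin (n i)) : Set α := W p.1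

/-- Hall's theorem. Only index sets `T` taken with all their copies need checking, because further
copies do not enlarge the union. Since `|B|` equals the number of sets, the representatives exhaust
`B`. -/
theorem isFullTransversal_of_card_le [Fintype κ] (n : κ → ℕ) (W : κ → Finset α) (B : Finset α)
    (hB : B.Nonempty) (hcard : B.card = ∑ i, n i)
    (h : ∀ T : Finset κ, ∑ i ∈ T, n i ≤ (B ∩ T.biUnion W).card) :
    IsFullTransversal (repeatedFamily n W) (B : Set α) := by
  have hall := (Finset.all_card_le_biUnion_card_iff_exists_injective
    (fun p : Σ i, Fin (n i) ↦ B ∩ W p.1)).1 fun s ↦ by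
      have h1 : s.card ≤ ∑ i ∈ s.image Sigma.fst, n i := by
        have h2 : s ⊆ (s.image Sigma.fst).sigma fun i ↦ (Finset.univ : Finset (Fin (n i))) := by
          intro p hp
          simpa using ⟨p.2, hp⟩
        simpa using Finset.card_le_card h2
      refine h1.trans ((h _).trans (Finset.card_le_card fun x hx ↦ ?_))
      simp only [Finset.mem_inter, Finset.mem_biUnion, Finset.mem_image] at hx ⊢
      obtain ⟨hxB, _, ⟨p, hp, rfl⟩, hx⟩ := hx
      exact ⟨p, hp, hxB, hx⟩
  obtain ⟨f, hf, hfW⟩ := hall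
  have himg : Finset.univ.image f = B := by
    refine Finset.eq_of_subset_of_card_le (fun x hx ↦ ?_) ?_
    · simp only [Finset.mem_image] at hx
      obtain ⟨p, -, rfl⟩ := hx
      exact Finset.inter_subset_left (hfW p)
    · rw [Finset.card_image_of_injective _ hf, hcard]
      simp
  obtain ⟨x, hx⟩ := hB
  rw [← himg, Finset.mem_image] at hx
  have : Nonempty (Σ i, Fin (n i)) := ⟨hx.choose⟩
  have hinv := Function.leftInverse_invFun hf
  have hmem : ∀ x ∈ B, ∃ p, f p = x := fun x hx ↦ by
    rw [← himg, Finset.mem_image] at hx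
    exact ⟨_, hx.choose_spec.2⟩
  refine ⟨Function.invFun f, ⟨fun _ _ ↦ Set.mem_univ _, fun x hx y hy hxy ↦ ?_, fun p _ ↦ ?_⟩,
    fun x hx ↦ ?_⟩
  · obtain ⟨p, rfl⟩ := hmem x hx
    obtain ⟨q, rfl⟩ := hmem y hy
    rw [hinv, hinv] at hxy
    rw [hxy]
  · exact ⟨f p, Finset.inter_subset_left (hfW p), hinv p⟩
  · obtain ⟨p, rfl⟩ := hmem x hx
    rw [hinv]
    exact Finset.inter_subset_right (hfW p)

theorem card_le_of_isFullTransversal {n : κ → ℕ} {W : κ → Finset α} {B : Finset α}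
    (h : IsFullTransversal (repeatedFamily n W) (B : Set α)) (T : Finset κ) :
    ∑ i ∈ T, n i ≤ (B ∩ T.biUnion W).card := by
  obtain ⟨φ, hφ, hφW⟩ := h
  have h1 : (T.sigma fun i ↦ (Finset.univ : Finset (Fin (n i)))) ⊆ (B ∩ T.biUnion W).image φ := by
    intro p hp
    obtain ⟨x, hx, rfl⟩ := hφ.surjOn (Set.mem_univ p)
    refine Finset.mem_image_of_mem _ (Finset.mem_inter.2 ⟨hx, Finset.mem_biUnion.2 ⟨_, ?_, hφW x hx⟩⟩)
    simpa using hp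
  have := (Finset.card_le_card h1).trans Finset.card_image_le
  simpa using this

theorem card_eq_of_isFullTransversal [Fintype κ] {n : κ → ℕ} {W : κ → Finset α} {B : Finset α}
    (h : IsFullTransversal (repeatedFamily n W) (B : Set α)) : B.card = ∑ i, n i := by
  have h1 := card_le_of_isFullTransversal h Finset.univ
  obtain ⟨φ, hφ, -⟩ := h
  refine le_antisymm ?_ (h1.trans (Finset.card_le_card Finset.inter_subset_left))
  have : B.card ≤ (Finset.univ : Finset (Σ i, Fin (n i))).card :=
    Finset.card_le_card_of_injOn φ (fun _ _ ↦ Finset.mem_coe.2 (Finset.mem_univ _)) hφ.injOn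
  simpa using this

end Hall

/-! ### Blocks, and bases in terms of block counts -/

namespace BetaTuple

variable {α : Type*} [DecidableEq α] {k : ℕ}

/-- The six sets of the tuple. -/
def block (β : BetaTuple α k) : Fin 6 → Finset α := ![β.A, β.B, β.C, β.D, β.E, β.F]

/-- The union of the sets with index in `u`. -/
def blocks (β : BetaTuple α k) (u : Finset (Fin 6)) : Finset α := u.biUnion β.block

theorem disjoint_block (β : BetaTuple α k) {s t : Fin 6} (h : s ≠ t) :
    Disjoint (β.block s) (β.block t) := by
  have hd := β.disjoint
  simp only [List.pairwise_cons, List.mem_cons, List.not_mem_nil, or_false, forall_eq_or_imp,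
    forall_eq, List.Pairwise.nil, and_true, false_imp_iff, implies_true] at hd
  obtain ⟨⟨h1, h2, h3, h4, h5⟩, ⟨h6, h7, h8, h9⟩, ⟨h10, h11, h12⟩, ⟨h13, h14⟩, h15⟩ := hd
  fin_cases s <;> fin_cases t <;> first | exact absurd rfl h | assumption | (symm; assumption)

/-- The numbers of elements of the six sets are constrained by `k`. -/
theorem sizes (β : BetaTuple α k) :
    0 < β.A.card ∧ 0 < β.B.card ∧ 0 < β.D.card ∧ 0 < β.E.card ∧
      β.A.card + β.B.card = k ∧ β.D.card + β.E.card = k ∧ β.C.card = k ∧ β.F.card = k := by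
  have hn := β.nonempty
  simp only [List.mem_cons, List.not_mem_nil, or_false, forall_eq_or_imp, forall_eq,
    ← Finset.card_pos] at hn
  have hAB : Disjoint β.A β.B := β.disjoint_block (s := 0) (t := 1) (by decide)
  have hDE : Disjoint β.D β.E := β.disjoint_block (s := 3) (t := 4) (by decide)
  exact ⟨hn.1, hn.2.1, hn.2.2.2.1, hn.2.2.2.2.1,
    by rw [← Finset.card_union_of_disjoint hAB, β.card_AB],
    by rw [← Finset.card_union_of_disjoint hDE, β.card_DE], β.card_C, β.card_F⟩

/-- The number of elements of `X` in each of the six sets. -/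
def count (β : BetaTuple α k) (X : Finset α) (t : Fin 6) : ℕ := (X ∩ β.block t).card

theorem card_inter_blocks (β : BetaTuple α k) (X : Finset α) (u : Finset (Fin 6)) :
    (X ∩ β.blocks u).card = ∑ t ∈ u, β.count X t := by
  rw [blocks, Finset.inter_biUnion, Finset.card_biUnion]
  · rfl
  · intro s _ t _ hst
    exact (β.disjoint_block hst).mono Finset.inter_subset_right Finset.inter_subset_right

theorem ground_eq_blocks (β : BetaTuple α k) : β.ground = β.blocks Finset.univ := by
  ext x
  simp [ground, blocks, block, Fin.exists_fin_succ]

/-- The indices of the sets that make up the members of `𝒵`. -/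
def flatIndex : Fin 7 → Finset (Fin 6) :=
  ![Finset.univ, {0, 1, 3, 4}, {2, 1, 4}, {2, 0, 3}, {5, 4, 0}, {5, 3, 1}, ∅]

theorem flat_eq_blocks (β : BetaTuple α k) (i : Fin 7) : β.flat i = β.blocks (flatIndex i) := by
  fin_cases i
  · exact β.ground_eq_blocks
  all_goals
    ext x
    simp [flat, flatIndex, blocks, block]

theorem card_eq_sum_count (β : BetaTuple α k) {X : Finset α} (hX : X ⊆ β.ground) :
    X.card = ∑ t, β.count X t := by
  rw [← card_inter_blocks, ← ground_eq_blocks, Finset.inter_eq_left.2 hX]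

theorem count_le (β : BetaTuple α k) (X : Finset α) :
    β.count X 0 ≤ β.A.card ∧ β.count X 1 ≤ β.B.card ∧ β.count X 2 ≤ k ∧ β.count X 3 ≤ β.D.card ∧
      β.count X 4 ≤ β.E.card ∧ β.count X 5 ≤ k := by
  have h : ∀ t, β.count X t ≤ (β.block t).card := fun t ↦ Finset.card_le_card Finset.inter_subset_right
  exact ⟨h 0, h 1, (h 2).trans_eq β.card_C, h 3, h 4, (h 5).trans_eq β.card_F⟩

theorem indep_coe_iff (β : BetaTuple α k) {I : Finset α} :
    β.matroid.Indep (I : Set α) ↔ I ⊆ β.ground ∧ ∀ i, (I ∩ β.flat i).card ≤ β.rank i := by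
  rw [matroid_indep_iff, Finset.coe_subset]
  simp only [← Finset.coe_inter, Set.encard_coe_eq_coe_finsetCard, Nat.cast_le]

/-- The lower bounds on a set of `2k` elements that make it a base. -/
def IsBaseCount (a b d e k : ℕ) (c : Fin 6 → ℕ) : Prop :=
  c 0 + c 1 + c 2 + c 3 + c 4 + c 5 = 2 * k ∧ 1 ≤ c 2 + c 5 ∧ a ≤ c 5 + c 0 + c 3 ∧
    b ≤ c 5 + c 1 + c 4 ∧ d ≤ c 2 + c 1 + c 3 ∧ e ≤ c 2 + c 0 + c 4

/-- For `2k` elements, an upper bound `r(Z)` inside `Z` is the lower bound `2k - r(Z)` outside it.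
The members `S` and `∅` contribute nothing further. -/
theorem indep_and_card_iff (β : BetaTuple α k) {B : Finset α} :
    β.matroid.Indep (B : Set α) ∧ B.card = 2 * k ↔
      B ⊆ β.ground ∧ IsBaseCount β.A.card β.B.card β.D.card β.E.card k (β.count B) := by
  rw [indep_coe_iff, and_assoc]
  refine and_congr_right fun hB ↦ ?_
  obtain ⟨h1, h2, h3, h4, h5, h6, -⟩ := β.sizes
  rw [card_eq_sum_count β hB]
  simp only [Fin.forall_fin_succ, flat_eq_blocks, card_inter_blocks, flatIndex, rank, IsBaseCount]
  simp [Fin.sum_univ_succ]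
  generalize β.count B = c
  omega

end BetaTuple

namespace BetaTuple

/-! ### Numerical forms of Hall's condition -/

/-- Hall's condition for a family of unions of blocks in terms of numbers of elements. -/
def HallCount (n : Fin 6 → ℕ) (w : Fin 6 → Finset (Fin 6)) (c : Fin 6 → ℕ) : Prop :=
  ∀ T : Finset (Fin 6), ∑ i ∈ T, n i ≤ ∑ t ∈ T.biUnion w, c t

/-- With the index set given as a predicate, both sides become explicit sums of conditionals, and
Hall's condition splits into 64 cases of linear arithmetic. -/
theorem hallCount_of_forall_pred {n : Fin 6 → ℕ} {w : Fin 6 → Finset (Fin 6)} {c : Fin 6 → ℕ}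
    (h : ∀ p : Fin 6 → Prop, ∀ [DecidablePred p],
      ∑ i, (if p i then n i else 0) ≤ ∑ t, (if ∃ i, p i ∧ t ∈ w i then c t else 0)) :
    HallCount n w c := by
  intro T
  have := h (· ∈ T)
  rw [Finset.sum_ite_mem, Finset.univ_inter] at this
  refine this.trans (le_of_eq ?_)
  rw [← Finset.sum_filter]
  refine Finset.sum_congr ?_ fun _ _ ↦ rfl
  ext t
  simp

/-- The complements of five members of `𝒵`, in terms of indices, preceded by `w`. -/
def complFamily (w : Finset (Fin 6)) : Fin 6 → Finset (Fin 6) :=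
  ![w, {2, 5}, {5, 0, 3}, {5, 1, 4}, {2, 1, 3}, {2, 0, 4}]

/-- The constraints on the sizes of the blocks. -/
def AreSizes (a b d e k : ℕ) : Prop := 0 < a ∧ 0 < b ∧ 0 < d ∧ 0 < e ∧ a + b = k ∧ d + e = k

/-- The upper bounds on the numbers of elements in the blocks. -/
def CountLe (a b d e k : ℕ) (c : Fin 6 → ℕ) : Prop :=
  c 0 ≤ a ∧ c 1 ≤ b ∧ c 2 ≤ k ∧ c 3 ≤ d ∧ c 4 ≤ e ∧ c 5 ≤ k

/-- The numbers `c` with the number for `s` increased by one. -/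
def addOne (s : Fin 6) (c : Fin 6 → ℕ) (t : Fin 6) : ℕ := c t + if t = s then 1 else 0

section

variable {a b d e k : ℕ} {c c' : Fin 6 → ℕ}

theorem hallCount_contract_A (hs : AreSizes a b d e k) (hle : CountLe a b d e k (addOne 0 c))
    (hc : IsBaseCount a b d e k (addOne 0 c)) :
    HallCount ![0, 1, a - 1, b, d, e - 1] (complFamily Finset.univ) c := by
  refine hallCount_of_forall_pred fun p _ ↦ ?_
  simp only [AreSizes, CountLe, IsBaseCount, addOne] at *
  simp only [Fin.sum_univ_succ, Fin.exists_fin_succ, complFamily]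
  simp at *
  generalize c 0 = c0 at *
  generalize c 1 = c1 at *
  generalize c 2 = c2 at *
  generalize c 3 = c3 at *
  generalize c 4 = c4 at *
  generalize c 5 = c5 at *
  by_cases p0 : p 0 <;> by_cases p1 : p 1 <;> by_cases p2 : p 2 <;> by_cases p3 : p 3 <;>
    by_cases p4 : p 4 <;> by_cases p5 : p 5 <;>
    simp only [p0, p1, p2, p3, p4, p5, if_true, if_false, or_true, or_false] <;> omega

theorem hallCount_contract_C (hs : AreSizes a b d e k) (hle : CountLe a b d e k (addOne 2 c))
    (hc : IsBaseCount a b d e k (addOne 2 c)) :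
    HallCount ![1, 0, a, b, d - 1, e - 1] (complFamily Finset.univ) c := by
  refine hallCount_of_forall_pred fun p _ ↦ ?_
  simp only [AreSizes, CountLe, IsBaseCount, addOne] at *
  simp only [Fin.sum_univ_succ, Fin.exists_fin_succ, complFamily]
  simp at *
  generalize c 0 = c0 at *
  generalize c 1 = c1 at *
  generalize c 2 = c2 at *
  generalize c 3 = c3 at *
  generalize c 4 = c4 at *
  generalize c 5 = c5 at *
  by_cases p0 : p 0 <;> by_cases p1 : p 1 <;> by_cases p2 : p 2 <;> by_cases p3 : p 3 <;>
    by_cases p4 : p 4 <;> by_cases p5 : p 5 <;>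
    simp only [p0, p1, p2, p3, p4, p5, if_true, if_false, or_true, or_false] <;> omega

/-- The strict inequality is Hall's condition for `C` together with the `e` copies of `A ∪ C ∪ E`.
-/
theorem hallCount_split_C_of_lt_E (hs : AreSizes a b d e k) (hle : CountLe a b d e k c) (hc : IsBaseCount a b d e k c)
    (h2 : 1 ≤ c 2) (h : e < c 2 + c 0 + c 4) :
    HallCount ![1, 0, a, b, d - 1, e] (complFamily {2}) c := by
  refine hallCount_of_forall_pred fun p _ ↦ ?_
  simp only [AreSizes, CountLe, IsBaseCount] at *
  simp only [Fin.sum_univ_succ, Fin.exists_fin_succ, complFamily]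
  simp at *
  generalize c 0 = c0 at *
  generalize c 1 = c1 at *
  generalize c 2 = c2 at *
  generalize c 3 = c3 at *
  generalize c 4 = c4 at *
  generalize c 5 = c5 at *
  by_cases p0 : p 0 <;> by_cases p1 : p 1 <;> by_cases p2 : p 2 <;> by_cases p3 : p 3 <;>
    by_cases p4 : p 4 <;> by_cases p5 : p 5 <;>
    simp only [p0, p1, p2, p3, p4, p5, if_true, if_false, or_true, or_false] <;> omega

theorem hallCount_split_C_of_lt_D (hs : AreSizes a b d e k) (hle : CountLe a b d e k c) (hc : IsBaseCount a b d e k c)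
    (h2 : 1 ≤ c 2) (h : d < c 2 + c 1 + c 3) :
    HallCount ![1, 0, a, b, d, e - 1] (complFamily {2}) c := by
  refine hallCount_of_forall_pred fun p _ ↦ ?_
  simp only [AreSizes, CountLe, IsBaseCount] at *
  simp only [Fin.sum_univ_succ, Fin.exists_fin_succ, complFamily]
  simp at *
  generalize c 0 = c0 at *
  generalize c 1 = c1 at *
  generalize c 2 = c2 at *
  generalize c 3 = c3 at *
  generalize c 4 = c4 at *
  generalize c 5 = c5 at *
  by_cases p0 : p 0 <;> by_cases p1 : p 1 <;> by_cases p2 : p 2 <;> by_cases p3 : p 3 <;>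
    by_cases p4 : p 4 <;> by_cases p5 : p 5 <;>
    simp only [p0, p1, p2, p3, p4, p5, if_true, if_false, or_true, or_false] <;> omega

/-- Either equality, with the upper bounds on the other blocks, forces `F` to be met. Then `C ∪ F`
contains the two elements that the members `C` and `C ∪ F` require. -/
theorem hallCount_split_C_of_eq (hs : AreSizes a b d e k) (hle : CountLe a b d e k c) (hc : IsBaseCount a b d e k c)
    (h2 : 1 ≤ c 2) (h : e = c 2 + c 0 + c 4 ∨ d = c 2 + c 1 + c 3) :
    HallCount ![1, 1, a, b, d - 1, e - 1] (complFamily {2}) c := by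
  refine hallCount_of_forall_pred fun p _ ↦ ?_
  simp only [AreSizes, CountLe, IsBaseCount] at *
  simp only [Fin.sum_univ_succ, Fin.exists_fin_succ, complFamily]
  simp at *
  generalize c 0 = c0 at *
  generalize c 1 = c1 at *
  generalize c 2 = c2 at *
  generalize c 3 = c3 at *
  generalize c 4 = c4 at *
  generalize c 5 = c5 at *
  by_cases p0 : p 0 <;> by_cases p1 : p 1 <;> by_cases p2 : p 2 <;> by_cases p3 : p 3 <;>
    by_cases p4 : p 4 <;> by_cases p5 : p 5 <;>
    simp only [p0, p1, p2, p3, p4, p5, if_true, if_false, or_true, or_false] <;> omega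

theorem hallCount_split_A (hs : AreSizes a b d e k) (hle : CountLe a b d e k c) (hc : IsBaseCount a b d e k c)
    (hc' : IsBaseCount a b d e k c') (hadd : ∀ t, c t + c' t = ![a, b, k, d, e, k] t)
    (h0 : 1 ≤ c 0) (h0' : 1 ≤ c' 0) :
    HallCount ![1, 1, a - 1, b, d, e - 1] (complFamily {0}) c := by
  refine hallCount_of_forall_pred fun p _ ↦ ?_
  simp only [AreSizes, CountLe, IsBaseCount] at *
  simp only [Fin.sum_univ_succ, Fin.exists_fin_succ, complFamily]
  simp [Fin.forall_fin_succ] at *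
  generalize c 0 = c0 at *
  generalize c 1 = c1 at *
  generalize c 2 = c2 at *
  generalize c 3 = c3 at *
  generalize c 4 = c4 at *
  generalize c 5 = c5 at *
  generalize c' 0 = x0 at *
  generalize c' 1 = x1 at *
  generalize c' 2 = x2 at *
  generalize c' 3 = x3 at *
  generalize c' 4 = x4 at *
  generalize c' 5 = x5 at *
  by_cases p0 : p 0 <;> by_cases p1 : p 1 <;> by_cases p2 : p 2 <;> by_cases p3 : p 3 <;>
    by_cases p4 : p 4 <;> by_cases p5 : p 5 <;>
    simp only [p0, p1, p2, p3, p4, p5, if_true, if_false, or_true, or_false] <;> omega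

end

end BetaTuple

/-- `I` is a partial transversal of the family `W`. -/
def IsPartialTransversal {α ι : Type*} (W : ι → Set α) (I : Set α) : Prop :=
  ∃ φ : I → ι, Function.Injective φ ∧ ∀ x : I, (x : α) ∈ W (φ x)

theorem IsFullTransversal.isPartialTransversal {α ι : Type*} {W : ι → Set α} {B I : Set α}
    (h : IsFullTransversal W B) (hI : I ⊆ B) : IsPartialTransversal W I := by
  obtain ⟨φ, hφ, hφW⟩ := h
  exact ⟨fun x ↦ φ x, fun x y hxy ↦ Subtype.ext (hφ.injOn (hI x.2) (hI y.2) hxy),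
    fun x ↦ hφW x (hI x.2)⟩

/-- This lifts an exchange between transversals presenting a contraction of `x` to the bases
containing `x`. -/
theorem SwapPair.insert {α : Type*} {P Q : Set α → Prop} {S₁ S₂ : Set α} {x : α}
    (h : SwapPair P S₁ S₂) (h₁ : x ∉ S₁) (h₂ : x ∉ S₂)
    (hPQ : ∀ S ⊆ S₁ ∪ S₂, P S → Q (Insert.insert x S)) :
    SwapPair Q (Insert.insert x S₁) (Insert.insert x S₂) := by
  obtain ⟨σ, hσ, h⟩ := h
  have e1 : Insert.insert x S₁ \ Insert.insert x S₂ = S₁ \ S₂ := by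
    ext z; by_cases hz : z = x <;> simp [hz, h₁]
  have e2 : Insert.insert x S₂ \ Insert.insert x S₁ = S₂ \ S₁ := by
    ext z; by_cases hz : z = x <;> simp [hz, h₂]
  refine ⟨σ, by rwa [e1, e2], fun X hX ↦ ?_⟩
  rw [e1] at hX
  have hxX : x ∉ X := fun hx ↦ h₁ (hX hx).1
  rw [Set.insert_sdiff_of_notMem _ hxX, Set.insert_union]
  refine hPQ _ (Set.union_subset_union Set.sdiff_subset ?_) (h X hX)
  exact ((Set.image_mono hX).trans hσ.image_eq.subset).trans Set.sdiff_subset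

theorem SwapPair.mono {α : Type*} {P Q : Set α → Prop} {S₁ S₂ : Set α}
    (h : SwapPair P S₁ S₂) (hPQ : ∀ S ⊆ S₁ ∪ S₂, P S → Q S) : SwapPair Q S₁ S₂ := by
  obtain ⟨σ, hσ, h⟩ := h
  refine ⟨σ, hσ, fun X hX ↦ hPQ _ (Set.union_subset_union Set.sdiff_subset ?_) (h X hX)⟩
  exact ((Set.image_mono hX).trans hσ.image_eq.subset).trans Set.sdiff_subset

namespace BetaTuple

variable {α : Type*} [DecidableEq α] {k : ℕ}

/-! ### Bases of `M_β` -/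

instance (β : BetaTuple α k) : β.matroid.Finite := ⟨β.ground.finite_toSet⟩

theorem count_blocks (β : BetaTuple α k) (u : Finset (Fin 6)) (t : Fin 6) :
    β.count (β.blocks u) t = if t ∈ u then (β.block t).card else 0 := by
  split_ifs with h
  · rw [count, blocks, Finset.inter_eq_right.2 (Finset.subset_biUnion_of_mem β.block h)]
  · rw [count, Finset.card_eq_zero, ← Finset.disjoint_iff_inter_eq_empty, blocks,
      Finset.disjoint_biUnion_left]
    exact fun s hs ↦ β.disjoint_block (by rintro rfl; exact h hs)

theorem blocks_subset_ground (β : BetaTuple α k) (u : Finset (Fin 6)) : β.blocks u ⊆ β.ground := by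
  rw [ground_eq_blocks]
  exact Finset.biUnion_subset_biUnion_of_subset_left _ (Finset.subset_univ u)

theorem blocks_ABC_indep (β : BetaTuple α k) :
    β.matroid.Indep (β.blocks {0, 1, 2} : Set α) ∧ (β.blocks {0, 1, 2}).card = 2 * k := by
  rw [indep_and_card_iff]
  refine ⟨β.blocks_subset_ground _, ?_⟩
  obtain ⟨h1, h2, h3, h4, h5, h6, h7, h8⟩ := β.sizes
  simp [IsBaseCount, count_blocks, block, -Finset.one_le_card]
  omega

theorem isBase_coe_iff (β : BetaTuple α k) {B : Finset α} :
    β.matroid.IsBase (B : Set α) ↔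
      B ⊆ β.ground ∧ IsBaseCount β.A.card β.B.card β.D.card β.E.card k (β.count B) := by
  have hle : ∀ I : Finset α, β.matroid.Indep (I : Set α) → I.card ≤ 2 * k := by
    intro I hI
    rw [indep_coe_iff] at hI
    have := hI.2 0
    have h0 : β.flat 0 = β.ground := rfl
    rwa [h0, Finset.inter_eq_left.2 hI.1] at this
  have hbase : ∀ I : Finset α, β.matroid.Indep (I : Set α) → I.card = 2 * k →
      β.matroid.IsBase (I : Set α) := by
    intro I hI hcard
    obtain ⟨B', hB', hIB'⟩ := hI.exists_isBase_superset
    lift B' to Finset α using β.matroid.set_finite B' hB'.subset_ground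
    rw [Finset.coe_subset] at hIB'
    rwa [Finset.eq_of_subset_of_card_le hIB' ((hle _ hB'.indep).trans hcard.ge)]
  rw [← indep_and_card_iff]
  refine ⟨fun h ↦ ⟨h.indep, ?_⟩, fun h ↦ hbase B h.1 h.2⟩
  have h1 := hbase _ β.blocks_ABC_indep.1 β.blocks_ABC_indep.2
  have h2 := h.encard_eq_encard_of_isBase h1
  rw [Set.encard_coe_eq_coe_finsetCard, Set.encard_coe_eq_coe_finsetCard,
    β.blocks_ABC_indep.2] at h2
  exact_mod_cast h2

theorem card_of_isBase (β : BetaTuple α k) {B : Finset α} (h : β.matroid.IsBase (B : Set α)) :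
    B.card = 2 * k :=
  (indep_and_card_iff β |>.2 (β.isBase_coe_iff.1 h)).2

theorem areSizes (β : BetaTuple α k) :
    AreSizes β.A.card β.B.card β.D.card β.E.card k := by
  obtain ⟨h1, h2, h3, h4, h5, h6, h7, h8⟩ := β.sizes
  exact ⟨h1, h2, h3, h4, h5, h6⟩

theorem countLe (β : BetaTuple α k) (X : Finset α) :
    CountLe β.A.card β.B.card β.D.card β.E.card k (β.count X) := β.count_le X

theorem count_insert (β : BetaTuple α k) {X : Finset α} {x : α} {s : Fin 6} (hx : x ∈ β.block s)
    (hX : x ∉ X) : β.count (insert x X) = addOne s (β.count X) := by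
  ext t
  rw [addOne, count, count]
  split_ifs with h
  · subst h
    rw [Finset.insert_inter_of_mem hx, Finset.card_insert_of_notMem (by simp [hX])]
  · rw [Finset.insert_inter_of_notMem
      (fun hxt ↦ Finset.disjoint_left.1 (β.disjoint_block h) hxt hx), add_zero]

/-! ### Symmetries -/

theorem matroid_eq_of_flat (β β' : BetaTuple α k) (π : Fin 7 → Fin 7)
    (hπ : Function.Surjective π) (hflat : ∀ i, β'.flat i = β.flat (π i))
    (hrank : ∀ i, β'.rank i = β.rank (π i)) (hg : β'.ground = β.ground) :
    β'.matroid = β.matroid := by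
  refine ext_indep (by rw [matroid_ground, matroid_ground, hg]) fun I _ ↦ ?_
  rw [matroid_indep_iff, matroid_indep_iff, hg]
  simp only [hflat, hrank]
  rw [hπ.forall (p := fun i ↦ (I ∩ (β.flat i : Set α)).encard ≤ (β.rank i : ℕ∞))]

/-- A tuple with the same matroid, in which `C` and `F` are interchanged. -/
def rotate (β : BetaTuple α k) : BetaTuple α k where
  A := β.D
  B := β.E
  C := β.F
  D := β.B
  E := β.A
  F := β.C
  nonempty := fun S hS ↦ β.nonempty S (by simp only [List.mem_cons] at *; tauto)
  disjoint := (List.Perm.pairwise_iff (fun h ↦ h.symm) (by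
    rw [← Multiset.coe_eq_coe]
    simp only [← Multiset.cons_coe, Multiset.coe_nil]
    ext s
    simp only [Multiset.count_cons, Multiset.count_zero]
    ring)).1 β.disjoint
  card_C := β.card_F
  card_F := β.card_C
  card_AB := β.card_DE
  card_DE := by rw [Finset.union_comm, β.card_AB]

theorem ground_rotate (β : BetaTuple α k) : β.rotate.ground = β.ground := by
  ext x
  simp only [ground, rotate, Finset.mem_union]
  tauto

theorem matroid_rotate (β : BetaTuple α k) : β.rotate.matroid = β.matroid := by
  refine matroid_eq_of_flat β β.rotate ![0, 1, 4, 5, 3, 2, 6] (by decide) ?_ ?_ β.ground_rotate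
  · intro i
    -- Under `rotate`, the blocks `A`, `D`, `B`, `E` are permuted cyclically and `C`, `F` are
    -- interchanged.
    fin_cases i <;> ext x <;> simp [flat, rotate, ground] <;> tauto
  · intro i
    fin_cases i <;> rfl

/-- If the sets `A`, `B`, `D`, `E` have the same size, then this tuple has the same matroid. -/
def swapped (β : BetaTuple α k) : BetaTuple α k where
  A := β.D
  B := β.E
  C := β.C
  D := β.A
  E := β.B
  F := β.F
  nonempty := fun S hS ↦ β.nonempty S (by simp only [List.mem_cons] at *; tauto)
  disjoint := (List.Perm.pairwise_iff (fun h ↦ h.symm) (by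
    rw [← Multiset.coe_eq_coe]
    simp only [← Multiset.cons_coe, Multiset.coe_nil]
    ext s
    simp only [Multiset.count_cons, Multiset.count_zero]
    ring)).1 β.disjoint
  card_C := β.card_C
  card_F := β.card_F
  card_AB := β.card_DE
  card_DE := β.card_AB

theorem ground_swapped (β : BetaTuple α k) : β.swapped.ground = β.ground := by
  ext x
  simp only [ground, swapped, Finset.mem_union]
  tauto

theorem matroid_swapped (β : BetaTuple α k) (h₁ : β.A.card = β.D.card) (h₂ : β.B.card = β.E.card)
    (h₃ : β.A.card = β.B.card) : β.swapped.matroid = β.matroid := by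
  refine matroid_eq_of_flat β β.swapped ![0, 1, 2, 3, 5, 4, 6] (by decide) ?_ ?_ β.ground_swapped
  · intro i
    fin_cases i <;> ext x <;> simp [flat, swapped, ground] <;> tauto
  · intro i
    fin_cases i <;> simp [rank, swapped] <;> omega

/-! ### Families of unions of blocks -/

theorem isFullTransversal_of_hallCount (β : BetaTuple α k) {n : Fin 6 → ℕ}
    {w : Fin 6 → Finset (Fin 6)} {B : Finset α} (hne : B.Nonempty) (hB : B ⊆ β.ground)
    (hcard : ∑ t, β.count B t = ∑ i, n i) (h : HallCount n w (β.count B)) :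
    IsFullTransversal (repeatedFamily n fun i ↦ β.blocks (w i)) (B : Set α) := by
  refine isFullTransversal_of_card_le _ _ _ hne (by rw [β.card_eq_sum_count hB, hcard]) fun T ↦ ?_
  have : T.biUnion (fun i ↦ β.blocks (w i)) = β.blocks (T.biUnion w) := by
    simp only [blocks, Finset.biUnion_biUnion]
  rw [this, card_inter_blocks]
  exact h T

theorem hallCount_of_isFullTransversal (β : BetaTuple α k) {n : Fin 6 → ℕ}
    {w : Fin 6 → Finset (Fin 6)} {B : Finset α}
    (h : IsFullTransversal (repeatedFamily n fun i ↦ β.blocks (w i)) (B : Set α)) :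
    HallCount n w (β.count B) := by
  intro T
  have : T.biUnion (fun i ↦ β.blocks (w i)) = β.blocks (T.biUnion w) := by
    simp only [blocks, Finset.biUnion_biUnion]
  rw [← card_inter_blocks, ← this]
  exact card_le_of_isFullTransversal h T

/-- Elements outside the `i`-th set can only represent the other sets, of which there are `∑ j, n j
- n i` counted with multiplicity. -/
theorem sum_count_add_le_of_isPartialTransversal (β : BetaTuple α k) {n : Fin 6 → ℕ}
    {w : Fin 6 → Finset (Fin 6)} {I : Finset α}
    (h : IsPartialTransversal (repeatedFamily n fun i ↦ β.blocks (w i)) (I : Set α)) (i : Fin 6) :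
    ∑ t ∈ (w i)ᶜ, β.count I t + n i ≤ ∑ j, n j := by
  obtain ⟨φ, hφ, hφW⟩ := h
  rw [← card_inter_blocks, ← Finset.sum_erase_add _ _ (Finset.mem_univ i)]
  gcongr
  have h1 : ((I ∩ β.blocks (w i)ᶜ).subtype (· ∈ (I : Set α))).card ≤
      ((Finset.univ.erase i).sigma fun j ↦ (Finset.univ : Finset (Fin (n j)))).card := by
    refine Finset.card_le_card_of_injOn φ (fun x hx ↦ ?_) hφ.injOn
    simp only [Finset.coe_sigma, Set.mem_sigma_iff, Finset.coe_univ, Set.mem_univ, and_true,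
      Finset.mem_coe, Finset.mem_erase, Finset.mem_univ]
    intro hi
    have h2 := hφW x
    simp only [repeatedFamily, hi] at h2
    simp only [Finset.mem_coe, Finset.mem_subtype, Finset.mem_inter] at hx
    have h3 := hx.2
    simp only [blocks, Finset.coe_biUnion, Set.mem_iUnion, Finset.mem_coe,
      Finset.mem_biUnion, Finset.mem_compl] at h2 h3
    obtain ⟨s, hs, hxs⟩ := h2
    obtain ⟨t, ht, hxt⟩ := h3
    exact Finset.disjoint_left.1 (β.disjoint_block (s := s) (t := t)
      (by rintro rfl; exact ht hs)) hxs hxt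
  rw [Finset.card_subtype, Finset.filter_true_of_mem] at h1
  · simpa using h1
  · intro x hx
    exact Finset.mem_of_mem_inter_left hx

end BetaTuple

/-! ### Transversal contractions, and single-element minors -/

namespace BetaTuple

variable {α : Type*} [DecidableEq α] {k : ℕ}

/-- Statements about the elements of the ground set need to be shown for elements of `A` and `C`
only. -/
theorem forall_mem_ground_of_A_of_C {p : Matroid α → α → Prop}
    (hA : ∀ β : BetaTuple α k, ∀ x ∈ β.A, p β.matroid x)
    (hC : ∀ β : BetaTuple α k, ∀ x ∈ β.C, p β.matroid x) (β : BetaTuple α k) :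
    ∀ x ∈ β.ground, p β.matroid x := by
  intro x hx
  simp only [ground, Finset.mem_union] at hx
  rcases hx with ((((h | h) | h) | h) | h) | h
  · exact hA β x h
  · rw [← matroid_rotate, ← matroid_rotate]; exact hA β.rotate.rotate x h
  · exact hC β x h
  · rw [← matroid_rotate]; exact hA β.rotate x h
  · rw [← matroid_rotate, ← matroid_rotate, ← matroid_rotate]; exact hA β.rotate.rotate.rotate x h
  · rw [← matroid_rotate]; exact hC β.rotate x h

/-- The family of sets `W`, with multiplicities `n`, presents the contraction of `x`. -/
def PresentsContraction (M : Matroid α) (x : α) (n : Fin 6 → ℕ) (W : Fin 6 → Finset α) : Prop :=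
  (∀ i, (W i : Set α) ⊆ M.E) ∧
    (∀ I : Set α, I ⊆ M.E → x ∉ I → IsPartialTransversal (repeatedFamily n W) I →
      M.Indep (insert x I)) ∧
    (∀ B : Set α, x ∉ B → M.IsBase (insert x B) → IsFullTransversal (repeatedFamily n W) B) ∧
    M.eRank = ((∑ i, n i + 1 : ℕ) : ℕ∞)

/-- Everything depends on block counts only. What is left are two arithmetic facts: partial
transversals plus `x` respect the ranks of `𝒵`, and bases through `x` without `x` satisfy Hall's
condition. -/
theorem presentsContraction_of_block (β : BetaTuple α k) {x : α} {s : Fin 6}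
    (hx : x ∈ β.block s) (n : Fin 6 → ℕ) (w : Fin 6 → Finset (Fin 6))
    (hn : ∑ i, n i + 1 = 2 * k)
    (hind : ∀ I : Finset α, x ∉ I → I ⊆ β.ground → ∑ t, β.count I t ≤ ∑ j, n j →
      (∀ i, ∑ t ∈ (w i)ᶜ, β.count I t + n i ≤ ∑ j, n j) →
      ∀ i, ∑ t ∈ flatIndex i, addOne s (β.count I) t ≤ β.rank i)
    (hall : ∀ c, CountLe β.A.card β.B.card β.D.card β.E.card k (addOne s c) →
      IsBaseCount β.A.card β.B.card β.D.card β.E.card k (addOne s c) → HallCount n w c) :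
    PresentsContraction β.matroid x n fun i ↦ β.blocks (w i) := by
  have hxg : x ∈ β.ground := by
    rw [ground_eq_blocks]
    exact Finset.mem_biUnion.2 ⟨s, Finset.mem_univ s, hx⟩
  refine ⟨fun i ↦ Finset.coe_subset.2 (β.blocks_subset_ground _), fun I hI hxI hpt ↦ ?_,
    fun B hxB hB ↦ ?_, ?_⟩
  · lift I to Finset α using β.matroid.set_finite I hI
    have hI' : I ⊆ β.ground := by exact_mod_cast hI
    rw [← Finset.coe_insert, indep_coe_iff]
    refine ⟨Finset.insert_subset hxg hI', fun i ↦ ?_⟩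
    rw [flat_eq_blocks, card_inter_blocks, count_insert β hx (by simpa using hxI)]
    refine hind I (by simpa using hxI) hI' ?_
      (fun i ↦ β.sum_count_add_le_of_isPartialTransversal hpt i) i
    rw [← card_eq_sum_count β hI']
    obtain ⟨φ, hφ, -⟩ := hpt
    have := Fintype.card_le_of_injective φ hφ
    simpa using this
  · lift B to Finset α using
      β.matroid.set_finite B ((Set.subset_insert _ _).trans hB.subset_ground)
    rw [← Finset.coe_insert] at hB
    have hxB' : x ∉ B := by simpa using hxB
    have h1 := β.isBase_coe_iff.1 hB
    have h2 := β.card_of_isBase hB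
    have hBg : B ⊆ β.ground := (Finset.subset_insert _ _).trans h1.1
    rw [Finset.card_insert_of_notMem hxB'] at h2
    rw [count_insert β hx hxB'] at h1
    refine β.isFullTransversal_of_hallCount (Finset.card_pos.1 (by omega)) hBg ?_
      (hall _ ?_ h1.2)
    · rw [← card_eq_sum_count β hBg]; omega
    · rw [← count_insert β hx hxB']; exact β.countLe _
  · rw [← β.isBase_coe_iff.2 (indep_and_card_iff β |>.1 β.blocks_ABC_indep) |>.encard_eq_eRank,
      Set.encard_coe_eq_coe_finsetCard, β.blocks_ABC_indep.2, hn]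

theorem exists_presentsContraction (hk : 2 ≤ k) (β : BetaTuple α k) :
    ∀ x ∈ β.ground, ∃ n W, PresentsContraction β.matroid x n W := by
  -- An element of `A` uses up one copy each of `A ∪ D ∪ F` and `A ∪ C ∪ E`. An element of `C` uses
  -- up `C ∪ F` and one copy each of `B ∪ C ∪ D` and `A ∪ C ∪ E`, which is one set too many, so the
  -- whole ground set is added once. Both families then have `2k - 1` members.
  refine forall_mem_ground_of_A_of_C (p := fun M x ↦ ∃ n W, PresentsContraction M x n W)
    (fun β x hx ↦ ⟨_, _, β.presentsContraction_of_block (s := 0) hx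
      ![0, 1, β.A.card - 1, β.B.card, β.D.card, β.E.card - 1] (complFamily Finset.univ) ?_ ?_
      fun c hle hc ↦ hallCount_contract_A β.areSizes hle hc⟩)
    (fun β x hx ↦ ⟨_, _, β.presentsContraction_of_block (s := 2) hx
      ![1, 0, β.A.card, β.B.card, β.D.card - 1, β.E.card - 1] (complFamily Finset.univ) ?_ ?_
      fun c hle hc ↦ hallCount_contract_C β.areSizes hle hc⟩) β
  · obtain ⟨h1, h2, h3, h4, h5, h6, -⟩ := β.sizes
    simp [Fin.sum_univ_succ]
    omega
  · intro I _ _ h0 h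
    obtain ⟨h1, h2, h3, h4, h5, h6, -⟩ := β.sizes
    generalize β.count I = c at *
    have e : ({2, 5}ᶜ : Finset (Fin 6)) = {0, 1, 3, 4} ∧ ({5, 0, 3}ᶜ : Finset (Fin 6)) = {2, 1, 4} ∧
        ({5, 1, 4}ᶜ : Finset (Fin 6)) = {2, 0, 3} ∧ ({2, 1, 3}ᶜ : Finset (Fin 6)) = {5, 4, 0} ∧
        ({2, 0, 4}ᶜ : Finset (Fin 6)) = {5, 3, 1} := by decide
    simp only [Fin.forall_fin_succ, complFamily, flatIndex, rank, addOne] at h ⊢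
    simp [Fin.sum_univ_succ, e] at h h0 ⊢
    omega
  · obtain ⟨h1, h2, h3, h4, h5, h6, -⟩ := β.sizes
    simp [Fin.sum_univ_succ]
    omega
  · intro I _ _ h0 h
    obtain ⟨h1, h2, h3, h4, h5, h6, -⟩ := β.sizes
    generalize β.count I = c at *
    have e : ({2, 5}ᶜ : Finset (Fin 6)) = {0, 1, 3, 4} ∧ ({5, 0, 3}ᶜ : Finset (Fin 6)) = {2, 1, 4} ∧
        ({5, 1, 4}ᶜ : Finset (Fin 6)) = {2, 0, 3} ∧ ({2, 1, 3}ᶜ : Finset (Fin 6)) = {5, 4, 0} ∧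
        ({2, 0, 4}ᶜ : Finset (Fin 6)) = {5, 3, 1} := by decide
    simp only [Fin.forall_fin_succ, complFamily, flatIndex, rank, addOne] at h ⊢
    simp [Fin.sum_univ_succ, e] at h h0 ⊢
    omega

/-- Two bases with a common element have a serial exchange. -/
theorem swapPair_of_mem_inter (hk : 2 ≤ k) (β : BetaTuple α k) {B₁ B₂ : Set α} {x : α}
    (h₁ : β.matroid.IsBase B₁) (h₂ : β.matroid.IsBase B₂) (hx₁ : x ∈ B₁) (hx₂ : x ∈ B₂) :
    SwapPair β.matroid.IsBase B₁ B₂ := by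
  obtain ⟨n, W, hW, hind, hbase, hrank⟩ := β.exists_presentsContraction hk x
    (by exact_mod_cast h₁.subset_ground hx₁)
  have e₁ : insert x (B₁ \ {x}) = B₁ := by simp [hx₁]
  have e₂ : insert x (B₂ \ {x}) = B₂ := by simp [hx₂]
  -- With `x` removed, both bases are full transversals of the same family.
  have t₁ := hbase (B₁ \ {x}) (by simp) (by rwa [e₁])
  have t₂ := hbase (B₂ \ {x}) (by simp) (by rwa [e₂])
  have := (IsFullTransversal.swapPair (β.matroid.set_finite _
    (Set.sdiff_subset.trans h₁.subset_ground)) t₁ t₂).insert (Q := β.matroid.IsBase) (x := x)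
    (by simp) (by simp) fun S hS hST ↦ ?_
  · rwa [e₁, e₂] at this
  have hxS : x ∉ S := fun h ↦ by simpa using hS h
  have hSE : S ⊆ β.matroid.E := hS.trans (Set.union_subset
    (Set.sdiff_subset.trans h₁.subset_ground) (Set.sdiff_subset.trans h₂.subset_ground))
  have hI := hind S hSE hxS (hST.isPartialTransversal subset_rfl)
  obtain ⟨B, hB, hSB⟩ := hI.exists_isBase_superset
  have hSfin := β.matroid.set_finite S hSE
  lift S to Finset α using hSfin
  have hcard := card_eq_of_isFullTransversal hST
  -- A full transversal has one element fewer than the rank, so adding `x` to it gives an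
  -- independent set of full size.
  suffices insert x (S : Set α) = B by rwa [this]
  refine (β.matroid.set_finite _ hI.subset_ground).eq_of_subset_of_encard_le hSB ?_
  rw [hB.encard_eq_eRank, hrank, ← hcard, Set.encard_insert_of_notMem hxS,
    Set.encard_coe_eq_coe_finsetCard, Nat.cast_add, Nat.cast_one]

theorem isNonloop_of_mem_ground (hk : 2 ≤ k) (β : BetaTuple α k) {x : α} (hx : x ∈ β.ground) :
    β.matroid.IsNonloop x := by
  obtain ⟨n, W, hW, hind, -⟩ := β.exists_presentsContraction hk x hx
  rw [← indep_singleton]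
  simpa using hind ∅ (Set.empty_subset _) (by simp)
    ⟨fun z ↦ z.2.elim, fun z ↦ z.2.elim, fun z ↦ z.2.elim⟩

theorem contract_allSwap (hk : 2 ≤ k) (β : BetaTuple α k) :
    ∀ x ∈ β.matroid.E, (β.matroid ／ {x}).AllSwap := by
  intro x hx B₁ B₂ h₁ h₂
  have hnl := β.isNonloop_of_mem_ground hk (x := x) (by exact_mod_cast hx)
  rw [hnl.indep.contract_isBase_iff, Set.union_singleton, Set.disjoint_singleton_right] at h₁ h₂
  obtain ⟨σ, hσ, h⟩ := β.swapPair_of_mem_inter hk h₁.1 h₂.1 (Set.mem_insert _ _)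
    (Set.mem_insert _ _)
  have e1 : insert x B₁ \ insert x B₂ = B₁ \ B₂ := by
    ext z; by_cases hz : z = x <;> simp [hz, h₁.2]
  have e2 : insert x B₂ \ insert x B₁ = B₂ \ B₁ := by
    ext z; by_cases hz : z = x <;> simp [hz, h₂.2]
  rw [e1, e2] at hσ
  rw [e1] at h
  refine ⟨σ, hσ, fun X hX ↦ ?_⟩
  have hxX : x ∉ X := fun hx ↦ h₁.2 (hX hx).1
  rw [hnl.indep.contract_isBase_iff, Set.union_singleton, Set.disjoint_singleton_right]
  have := h X hX
  rw [Set.insert_sdiff_of_notMem _ hxX, Set.insert_union] at this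
  refine ⟨this, ?_⟩
  rintro (hx | hx)
  · exact h₁.2 hx.1
  · exact h₂.2 (hσ.image_eq.subset (Set.image_mono hX hx)).1

theorem card_ground (β : BetaTuple α k) : β.ground.card = 4 * k := by
  obtain ⟨h1, h2, h3, h4, h5, h6, h7, h8⟩ := β.sizes
  rw [β.card_eq_sum_count subset_rfl, β.ground_eq_blocks]
  simp only [count_blocks, Finset.mem_univ, if_true]
  simp [Fin.sum_univ_succ, block]
  omega

theorem blocks_ABC_isBase (β : BetaTuple α k) :
    β.matroid.IsBase (β.blocks {0, 1, 2} : Set α) :=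
  β.isBase_coe_iff.2 (β.indep_and_card_iff.1 β.blocks_ABC_indep)

theorem blocks_rotate_ABC (β : BetaTuple α k) :
    β.rotate.blocks {0, 1, 2} = β.blocks {3, 4, 5} := by
  simp [blocks, block, rotate]

theorem blocks_DEF_isBase (β : BetaTuple α k) :
    β.matroid.IsBase (β.blocks {3, 4, 5} : Set α) := by
  rw [← matroid_rotate, ← blocks_rotate_ABC]
  exact β.rotate.blocks_ABC_isBase

theorem disjoint_blocks (β : BetaTuple α k) {u v : Finset (Fin 6)} (h : Disjoint u v) :
    Disjoint (β.blocks u) (β.blocks v) := by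
  simp only [blocks, Finset.disjoint_biUnion_left, Finset.disjoint_biUnion_right]
  exact fun s hs t ht ↦ β.disjoint_block fun hst ↦ Finset.disjoint_left.1 h ht (hst ▸ hs)

theorem coindep_singleton (β : BetaTuple α k) {x : α} (hx : x ∈ β.matroid.E) :
    β.matroid.Coindep {x} := by
  rw [coindep_iff_exists (Set.singleton_subset_iff.2 hx)]
  by_cases h : x ∈ β.blocks {0, 1, 2}
  · refine ⟨_, β.blocks_DEF_isBase, Set.subset_sdiff_singleton β.blocks_DEF_isBase.subset_ground ?_⟩
    exact Finset.disjoint_left.1 (β.disjoint_blocks (by decide)) h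
  · exact ⟨_, β.blocks_ABC_isBase,
      Set.subset_sdiff_singleton β.blocks_ABC_isBase.subset_ground h⟩

/-- Two disjoint bases partition the ground set. -/
theorem union_eq_ground (β : BetaTuple α k) {B₁ B₂ : Finset α}
    (h₁ : β.matroid.IsBase (B₁ : Set α)) (h₂ : β.matroid.IsBase (B₂ : Set α))
    (hd : Disjoint B₁ B₂) : B₁ ∪ B₂ = β.ground := by
  refine Finset.eq_of_subset_of_card_le
    (Finset.union_subset (β.isBase_coe_iff.1 h₁).1 (β.isBase_coe_iff.1 h₂).1) ?_
  rw [Finset.card_union_of_disjoint hd, β.card_of_isBase h₁, β.card_of_isBase h₂, card_ground]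
  omega

theorem delete_allSwap (hk : 2 ≤ k) (β : BetaTuple α k) :
    ∀ x ∈ β.matroid.E, (β.matroid ＼ {x}).AllSwap := by
  intro x hx B₁ B₂ h₁ h₂
  have hco : β.matroid.Coindep {x} := β.coindep_singleton hx
  rw [hco.delete_isBase_iff, Set.disjoint_singleton_right] at h₁ h₂
  -- Disjoint bases would partition the ground set, but both avoid `x`.
  obtain ⟨y, hy₁, hy₂⟩ : ∃ y, y ∈ B₁ ∧ y ∈ B₂ := by
    by_contra! hcon
    have hg := h₁.1.subset_ground
    have hg' := h₂.1.subset_ground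
    lift B₁ to Finset α using β.matroid.set_finite _ hg
    lift B₂ to Finset α using β.matroid.set_finite _ hg'
    have := β.union_eq_ground h₁.1 h₂.1 (Finset.disjoint_left.2 (by exact_mod_cast hcon))
    have hx' : x ∈ B₁ ∪ B₂ := by rw [this]; exact_mod_cast hx
    rcases Finset.mem_union.1 hx' with h | h
    · exact h₁.2 h
    · exact h₂.2 h
  obtain ⟨σ, hσ, h⟩ := β.swapPair_of_mem_inter hk h₁.1 h₂.1 hy₁ hy₂
  refine ⟨σ, hσ, fun X hX ↦ ?_⟩
  rw [hco.delete_isBase_iff, Set.disjoint_singleton_right]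
  refine ⟨h X hX, ?_⟩
  rintro (hx | hx)
  · exact h₁.2 hx.1
  · exact h₂.2 (hσ.image_eq.subset (Set.image_mono hX hx)).1

theorem contract_isTransversal (hk : 2 ≤ k) (β : BetaTuple α k) :
    ∀ x ∈ β.matroid.E, (β.matroid ／ {x}).IsTransversal := by
  intro x hx
  have hx' : x ∈ β.ground := by exact_mod_cast hx
  have hnl := β.isNonloop_of_mem_ground hk hx'
  obtain ⟨n, W, hW, hind, hbase, -⟩ := β.exists_presentsContraction hk x hx'
  let e := Fintype.equivFin (Σ i, Fin (n i))
  refine ⟨_, fun j ↦ repeatedFamily n W (e.symm j) \ {x}, fun j ↦ ?_, fun I ↦ ?_⟩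
  · exact Set.sdiff_subset_sdiff_left (hW _)
  · rw [hnl.contractElem_indep_iff]
    constructor
    · rintro ⟨hxI, hI⟩
      obtain ⟨B, hB, hIB⟩ := hI.exists_isBase_superset
      have hxB : x ∈ B := hIB (Set.mem_insert _ _)
      have hB' := hbase (B \ {x}) (by simp) (by simpa [hxB] using hB)
      obtain ⟨φ, hφ, hφW⟩ := hB'.isPartialTransversal (I := I) fun z hz ↦
        ⟨hIB (Set.mem_insert_of_mem _ hz), fun hzx ↦ hxI (hzx ▸ hz)⟩
      refine ⟨e ∘ φ, e.injective.comp hφ, fun z ↦ ⟨?_, fun hzx ↦ hxI (hzx ▸ z.2)⟩⟩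
      simpa using hφW z
    · rintro ⟨φ, hφ, hφW⟩
      have hxI : x ∉ I := fun h ↦ (hφW ⟨x, h⟩).2 rfl
      refine ⟨hxI, hind I (fun z hz ↦ hW _ (hφW ⟨z, hz⟩).1) hxI
        ⟨e.symm ∘ φ, e.symm.injective.comp hφ, fun z ↦ (hφW z).1⟩⟩

end BetaTuple

namespace BetaTuple

variable {α : Type*} [DecidableEq α] {k : ℕ}

/-! ### Complementary bases -/

/-- Complementary bases. -/
def AreComplBases (β : BetaTuple α k) (B₁ B₂ : Finset α) : Prop :=
  β.matroid.IsBase (B₁ : Set α) ∧ β.matroid.IsBase (B₂ : Set α) ∧ Disjoint B₁ B₂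

theorem AreComplBases.symm {β : BetaTuple α k} {B₁ B₂ : Finset α} (h : β.AreComplBases B₁ B₂) :
    β.AreComplBases B₂ B₁ := ⟨h.2.1, h.1, h.2.2.symm⟩

theorem AreComplBases.rotate {β : BetaTuple α k} {B₁ B₂ : Finset α} (h : β.AreComplBases B₁ B₂) :
    β.rotate.AreComplBases B₁ B₂ := by
  rwa [AreComplBases, matroid_rotate]

theorem AreComplBases.count_add_count {β : BetaTuple α k} {B₁ B₂ : Finset α}
    (h : β.AreComplBases B₁ B₂) (t : Fin 6) :
    β.count B₁ t + β.count B₂ t = ![β.A.card, β.B.card, k, β.D.card, β.E.card, k] t := by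
  have hu := β.union_eq_ground h.1 h.2.1 h.2.2
  have : β.count B₁ t + β.count B₂ t = (β.block t).card := by
    rw [count, count, ← Finset.card_union_of_disjoint
      (h.2.2.mono Finset.inter_subset_left Finset.inter_subset_left), ← Finset.union_inter_distrib_right,
      hu, Finset.inter_eq_right.2]
    rw [ground_eq_blocks]
    exact Finset.subset_biUnion_of_mem β.block (Finset.mem_univ t)
  rw [this]
  fin_cases t <;> simp [block, β.card_C, β.card_F]

/-- The family only has to contain these two bases among its full transversals and to have no full
transversal that is not a base. It need not present the matroid. -/
theorem swapPair_of_hallCount (β : BetaTuple α k) {n : Fin 6 → ℕ}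
    {w : Fin 6 → Finset (Fin 6)} {B₁ B₂ : Finset α} (hk : 2 ≤ k) (hn : ∑ i, n i = 2 * k)
    (h₁ : β.matroid.IsBase (B₁ : Set α)) (h₂ : β.matroid.IsBase (B₂ : Set α))
    (hall₁ : HallCount n w (β.count B₁)) (hall₂ : HallCount n w (β.count B₂))
    (hbase : ∀ c : Fin 6 → ℕ, HallCount n w c → ∑ t, c t = 2 * k →
      IsBaseCount β.A.card β.B.card β.D.card β.E.card k c) :
    SwapPair β.matroid.IsBase (B₁ : Set α) (B₂ : Set α) := by
  have ht : ∀ B : Finset α, β.matroid.IsBase (B : Set α) → HallCount n w (β.count B) →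
      IsFullTransversal (repeatedFamily n fun i ↦ β.blocks (w i)) (B : Set α) := by
    intro B hB hall
    have hcard := β.card_of_isBase hB
    have hBg := (β.isBase_coe_iff.1 hB).1
    refine β.isFullTransversal_of_hallCount (Finset.card_pos.1 (by omega)) hBg ?_ hall
    rw [← card_eq_sum_count β hBg, hcard, hn]
  refine (IsFullTransversal.swapPair B₁.finite_toSet (ht B₁ h₁ hall₁) (ht B₂ h₂ hall₂)).mono
    fun S hS hST ↦ ?_
  have hSE : S ⊆ β.matroid.E := hS.trans (Set.union_subset h₁.subset_ground h₂.subset_ground)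
  have hSfin := β.matroid.set_finite S hSE
  lift S to Finset α using hSfin
  have hSg : S ⊆ β.ground := by exact_mod_cast hSE
  refine β.isBase_coe_iff.2 ⟨hSg, hbase _ (β.hallCount_of_isFullTransversal hST) ?_⟩
  rw [← card_eq_sum_count β hSg, card_eq_of_isFullTransversal hST, hn]

theorem AreComplBases.swapPair_of_split_A (hk : 2 ≤ k) {β : BetaTuple α k} {B₁ B₂ : Finset α}
    (h : β.AreComplBases B₁ B₂) (h₁ : 1 ≤ β.count B₁ 0) (h₂ : 1 ≤ β.count B₂ 0) :
    SwapPair β.matroid.IsBase (B₁ : Set α) (B₂ : Set α) := by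
  have hc₁ := (β.isBase_coe_iff.1 h.1).2
  have hc₂ := (β.isBase_coe_iff.1 h.2.1).2
  obtain ⟨h1, h2, h3, h4, h5, h6, -⟩ := β.sizes
  refine β.swapPair_of_hallCount (n := ![1, 1, β.A.card - 1, β.B.card, β.D.card, β.E.card - 1])
    (w := complFamily {0}) hk ?_ h.1 h.2.1
    (hallCount_split_A β.areSizes (β.countLe _) hc₁ hc₂ h.count_add_count h₁ h₂)
    (hallCount_split_A β.areSizes (β.countLe _) hc₂ hc₁ h.symm.count_add_count h₂ h₁) ?_
  · simp [Fin.sum_univ_succ]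
    omega
  · intro c hc hsum
    -- The single member `A` lies in both `A ∪ D ∪ F` and `A ∪ C ∪ E`, so it makes up for the copy
    -- taken from each. The index sets `{0, 2}` and `{0, 5}` recover these bounds.
    have g1 := hc {1}
    have g2 := hc {0, 2}
    have g3 := hc {3}
    have g4 := hc {4}
    have g5 := hc {0, 5}
    simp [complFamily, Fin.sum_univ_succ] at g1 g2 g3 g4 g5 hsum
    rw [IsBaseCount]
    omega

theorem AreComplBases.swapPair_of_split_C (hk : 2 ≤ k) {β : BetaTuple α k} {B₁ B₂ : Finset α}
    (h : β.AreComplBases B₁ B₂) (h₁ : 1 ≤ β.count B₁ 2) (h₂ : 1 ≤ β.count B₂ 2) :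
    SwapPair β.matroid.IsBase (B₁ : Set α) (B₂ : Set α) := by
  have hc₁ := (β.isBase_coe_iff.1 h.1).2
  have hc₂ := (β.isBase_coe_iff.1 h.2.1).2
  have hs := β.sizes
  obtain ⟨h1, h2, h3, h4, h5, h6, -⟩ := β.sizes
  have hle₁ := β.countLe B₁
  have hle₂ := β.countLe B₂
  have hadd := h.count_add_count
  -- The member `C` can make up for the lost copy of `C ∪ F` and one of `B ∪ C ∪ D`, provided
  -- neither base is tight on `A ∪ C ∪ E`. The next case exchanges the roles of `D` and `E`.
  by_cases hE : β.E.card < β.count B₁ 2 + β.count B₁ 0 + β.count B₁ 4 ∧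
      β.E.card < β.count B₂ 2 + β.count B₂ 0 + β.count B₂ 4
  · refine β.swapPair_of_hallCount (n := ![1, 0, β.A.card, β.B.card, β.D.card - 1, β.E.card])
      (w := complFamily {2}) hk ?_ h.1 h.2.1
      (hallCount_split_C_of_lt_E β.areSizes hle₁ hc₁ h₁ hE.1)
      (hallCount_split_C_of_lt_E β.areSizes hle₂ hc₂ h₂ hE.2) ?_
    · simp [Fin.sum_univ_succ]
      omega
    · intro c hc hsum
      have g1 := hc {0}
      have g2 := hc {2}
      have g3 := hc {3}
      have g4 := hc {0, 4}
      have g5 := hc {5}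
      simp [complFamily, Fin.sum_univ_succ] at g1 g2 g3 g4 g5 hsum
      rw [IsBaseCount]
      omega
  by_cases hD : β.D.card < β.count B₁ 2 + β.count B₁ 1 + β.count B₁ 3 ∧
      β.D.card < β.count B₂ 2 + β.count B₂ 1 + β.count B₂ 3
  · refine β.swapPair_of_hallCount (n := ![1, 0, β.A.card, β.B.card, β.D.card, β.E.card - 1])
      (w := complFamily {2}) hk ?_ h.1 h.2.1
      (hallCount_split_C_of_lt_D β.areSizes hle₁ hc₁ h₁ hD.1)
      (hallCount_split_C_of_lt_D β.areSizes hle₂ hc₂ h₂ hD.2) ?_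
    · simp [Fin.sum_univ_succ]
      omega
    · intro c hc hsum
      have g1 := hc {0}
      have g2 := hc {2}
      have g3 := hc {3}
      have g4 := hc {4}
      have g5 := hc {0, 5}
      simp [complFamily, Fin.sum_univ_succ] at g1 g2 g3 g4 g5 hsum
      rw [IsBaseCount]
      omega
  -- Now some base is tight on `A ∪ C ∪ E` and some base on `B ∪ C ∪ D`. No base that meets `C` is
  -- tight on both: the counts would give `|F| ≥ k + 1`. So each base is tight on one of them.
  have key : (β.E.card = β.count B₁ 2 + β.count B₁ 0 + β.count B₁ 4 ∨
      β.D.card = β.count B₁ 2 + β.count B₁ 1 + β.count B₁ 3) ∧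
      (β.E.card = β.count B₂ 2 + β.count B₂ 0 + β.count B₂ 4 ∨
      β.D.card = β.count B₂ 2 + β.count B₂ 1 + β.count B₂ 3) := by
    simp only [IsBaseCount, CountLe] at *
    omega
  refine β.swapPair_of_hallCount
    (n := ![1, 1, β.A.card, β.B.card, β.D.card - 1, β.E.card - 1])
    (w := complFamily {2}) hk ?_ h.1 h.2.1
    (hallCount_split_C_of_eq β.areSizes hle₁ hc₁ h₁ key.1)
    (hallCount_split_C_of_eq β.areSizes hle₂ hc₂ h₂ key.2) ?_
  · simp [Fin.sum_univ_succ]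
    omega
  · intro c hc hsum
    have g1 := hc {1}
    have g2 := hc {2}
    have g3 := hc {3}
    have g4 := hc {0, 4}
    have g5 := hc {0, 5}
    simp [complFamily, Fin.sum_univ_succ] at g1 g2 g3 g4 g5 hsum
    rw [IsBaseCount]
    omega

theorem block_rotate (β : BetaTuple α k) (t : Fin 6) :
    β.rotate.block t = β.block (![3, 4, 5, 1, 0, 2] t) := by
  fin_cases t <;> rfl

theorem AreComplBases.swapPair_of_split (hk : 2 ≤ k) {β : BetaTuple α k} {B₁ B₂ : Finset α}
    (h : β.AreComplBases B₁ B₂) (t : Fin 6) (h₁ : 1 ≤ β.count B₁ t) (h₂ : 1 ≤ β.count B₂ t) :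
    SwapPair β.matroid.IsBase (B₁ : Set α) (B₂ : Set α) := by
  have hr : ∀ (β : BetaTuple α k) (B : Finset α) (t : Fin 6),
      β.rotate.count B t = β.count B (![3, 4, 5, 1, 0, 2] t) := fun β B t ↦ by
    rw [count, block_rotate, count]
  fin_cases t
  · exact h.swapPair_of_split_A hk h₁ h₂
  · have := h.rotate.rotate.swapPair_of_split_A hk (by simpa [hr] using h₁) (by simpa [hr] using h₂)
    rwa [matroid_rotate, matroid_rotate] at this
  · exact h.swapPair_of_split_C hk h₁ h₂
  · have := h.rotate.swapPair_of_split_A hk (by simpa [hr] using h₁) (by simpa [hr] using h₂)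
    rwa [matroid_rotate] at this
  · have := h.rotate.rotate.rotate.swapPair_of_split_A hk
      (by simpa [hr] using h₁) (by simpa [hr] using h₂)
    rwa [matroid_rotate, matroid_rotate, matroid_rotate] at this
  · have := h.rotate.swapPair_of_split_C hk (by simpa [hr] using h₁) (by simpa [hr] using h₂)
    rwa [matroid_rotate] at this

/-- The sets `A`, `B`, `D`, `E` have the same size. -/
def Balanced (β : BetaTuple α k) : Prop :=
  2 * β.A.card = k ∧ 2 * β.B.card = k ∧ 2 * β.D.card = k ∧ 2 * β.E.card = k

theorem eq_blocks_of_count (β : BetaTuple α k) {B : Finset α} (hB : B ⊆ β.ground)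
    (u : Finset (Fin 6)) (h₁ : ∀ t ∉ u, β.count B t = 0)
    (h₂ : ∀ t ∈ u, (β.block t).card ≤ β.count B t) : B = β.blocks u := by
  refine Finset.Subset.antisymm (fun x hx ↦ ?_) (fun x hx ↦ ?_)
  · have hxg := hB hx
    rw [ground_eq_blocks, blocks, Finset.mem_biUnion] at hxg
    obtain ⟨t, -, hxt⟩ := hxg
    refine Finset.mem_biUnion.2 ⟨t, ?_, hxt⟩
    by_contra htu
    have h0 := Finset.card_eq_zero.1 (h₁ t htu)
    exact Finset.notMem_empty x (h0 ▸ Finset.mem_inter.2 ⟨hx, hxt⟩)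
  · obtain ⟨t, ht, hxt⟩ := Finset.mem_biUnion.1 hx
    have h3 := Finset.eq_of_subset_of_card_le Finset.inter_subset_right (h₂ t ht)
    rw [← h3] at hxt
    exact (Finset.mem_inter.1 hxt).1

/-- Here `C` lies in the first base and `F` in the second. If `A` is in the first base, the bounds
force `E` into the second, then `B` into the first and `D` into the second. If `A` is in the second,
they force `D` and `E` into the first and `B` into the second, and they read `|A| ≥ |E| ≥ |B| ≥ |D|
≥ |A|`. All four sizes are then `k/2`. -/
theorem counts_of_unsplit {a b d e k c₀ f₀ : ℕ} {c c' : Fin 6 → ℕ}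
    (hs : 0 < a ∧ 0 < b ∧ 0 < d ∧ 0 < e ∧ a + b = k ∧ d + e = k ∧ c₀ = k ∧ f₀ = k)
    (h5 : c 5 = 0) (h2 : c' 2 = 0) (hc : IsBaseCount a b d e k c) (hc' : IsBaseCount a b d e k c')
    (hadd : c 0 + c' 0 = a ∧ c 1 + c' 1 = b ∧ c 2 + c' 2 = k ∧ c 3 + c' 3 = d ∧
      c 4 + c' 4 = e ∧ c 5 + c' 5 = k)
    (hsplit : (c 0 = 0 ∨ c' 0 = 0) ∧ (c 1 = 0 ∨ c' 1 = 0) ∧ (c 2 = 0 ∨ c' 2 = 0) ∧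
      (c 3 = 0 ∨ c' 3 = 0) ∧ (c 4 = 0 ∨ c' 4 = 0) ∧ (c 5 = 0 ∨ c' 5 = 0)) :
    (c 3 = 0 ∧ c 4 = 0 ∧ c' 0 = 0 ∧ c' 1 = 0) ∨
      (2 * a = k ∧ 2 * b = k ∧ 2 * d = k ∧ 2 * e = k) ∧
        c 0 = 0 ∧ c 1 = 0 ∧ c' 3 = 0 ∧ c' 4 = 0 := by
  rw [IsBaseCount] at hc hc'
  obtain ⟨i0, i1, i2, i3, i4, i5⟩ := hsplit
  rcases i0 with i0 | i0
  · right
    have h3 : c' 3 = 0 := i3.resolve_left (by clear i1 i2 i3 i4 i5; omega)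
    have h1 : c 1 = 0 := i1.resolve_right (by clear i1 i2 i3 i4 i5; omega)
    have h4 : c' 4 = 0 := i4.resolve_left (by clear i1 i2 i3 i4 i5; omega)
    clear i1 i2 i3 i4 i5
    exact ⟨⟨by omega, by omega, by omega, by omega⟩, i0, h1, h3, h4⟩
  · left
    have h4 : c 4 = 0 := i4.resolve_right (by clear i1 i2 i3 i4 i5; omega)
    have h1 : c' 1 = 0 := i1.resolve_left (by clear i1 i2 i3 i4 i5; omega)
    have h3 : c 3 = 0 := i3.resolve_right (by clear i1 i2 i3 i4 i5; omega)
    exact ⟨h3, h4, i0, h1⟩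

/-- The pairs of bases without a serial exchange. -/
theorem eq_blocks_of_not_swapPair (hk : 2 ≤ k) (β : BetaTuple α k) {B₁ B₂ : Set α}
    (h₁ : β.matroid.IsBase B₁) (h₂ : β.matroid.IsBase B₂)
    (hn : ¬ SwapPair β.matroid.IsBase B₁ B₂) :
    s(B₁, B₂) = s((β.blocks {0, 1, 2} : Set α), (β.blocks {3, 4, 5} : Set α)) ∨
      β.Balanced ∧
        s(B₁, B₂) = s((β.blocks {3, 4, 2} : Set α), (β.blocks {0, 1, 5} : Set α)) := by
  have hg := h₁.subset_ground
  have hg' := h₂.subset_ground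
  lift B₁ to Finset α using β.matroid.set_finite _ hg
  lift B₂ to Finset α using β.matroid.set_finite _ hg'
  have hd : Disjoint B₁ B₂ := Finset.disjoint_left.2 fun x hx₁ hx₂ ↦
    hn (β.swapPair_of_mem_inter hk h₁ h₂ hx₁ hx₂)
  have h : β.AreComplBases B₁ B₂ := ⟨h₁, h₂, hd⟩
  have hg₁ := (β.isBase_coe_iff.1 h₁).1
  have hg₂ := (β.isBase_coe_iff.1 h₂).1
  have hadd := h.count_add_count
  -- Without a split block, each block lies entirely in one of the two bases.
  have hsplit : ∀ t, β.count B₁ t = 0 ∨ β.count B₂ t = 0 := by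
    intro t
    by_contra! hcon
    exact hn (h.swapPair_of_split hk t (by omega) (by omega))
  have hs := β.sizes
  have hcases : ((∀ t ∉ ({0, 1, 2} : Finset (Fin 6)), β.count B₁ t = 0) ∧
        (∀ t ∉ ({3, 4, 5} : Finset (Fin 6)), β.count B₂ t = 0)) ∨
      ((∀ t ∉ ({0, 1, 2} : Finset (Fin 6)), β.count B₂ t = 0) ∧
        (∀ t ∉ ({3, 4, 5} : Finset (Fin 6)), β.count B₁ t = 0)) ∨ β.Balanced ∧
      (((∀ t ∉ ({3, 4, 2} : Finset (Fin 6)), β.count B₁ t = 0) ∧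
        (∀ t ∉ ({0, 1, 5} : Finset (Fin 6)), β.count B₂ t = 0)) ∨
      ((∀ t ∉ ({3, 4, 2} : Finset (Fin 6)), β.count B₂ t = 0) ∧
        (∀ t ∉ ({0, 1, 5} : Finset (Fin 6)), β.count B₁ t = 0))) := by
    have hc₁ := (β.isBase_coe_iff.1 h₁).2
    have hc₂ := (β.isBase_coe_iff.1 h₂).2
    simp only [IsBaseCount, Fin.forall_fin_succ, Balanced] at *
    simp at hadd hsplit ⊢
    generalize β.count B₁ = c at *
    generalize β.count B₂ = c' at *
    clear h h₁ h₂ hn hd hg hg' hg₁ hg₂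
    by_cases h5 : c 5 = 0
    · have h2 : c' 2 = 0 := hsplit.2.2.1.resolve_left (by clear hsplit; omega)
      rcases counts_of_unsplit hs h5 h2 hc₁ hc₂ hadd hsplit with ⟨g1, g2, g3, g4⟩ | ⟨g0, g1, g2, g3, g4⟩
      · exact Or.inl ⟨⟨g1, g2, h5⟩, g3, g4, h2⟩
      · exact Or.inr (Or.inr ⟨g0, Or.inl ⟨⟨g1, g2, h5⟩, h2, g3, g4⟩⟩)
    · have h5' : c' 5 = 0 := hsplit.2.2.2.2.2.resolve_left h5
      have h2 : c 2 = 0 := hsplit.2.2.1.resolve_right (by clear hsplit; omega)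
      have hadd' : c' 0 + c 0 = β.A.card ∧ c' 1 + c 1 = β.B.card ∧ c' 2 + c 2 = k ∧
          c' 3 + c 3 = β.D.card ∧ c' 4 + c 4 = β.E.card ∧ c' 5 + c 5 = k := by
        simpa only [add_comm] using hadd
      have hsplit' : (c' 0 = 0 ∨ c 0 = 0) ∧ (c' 1 = 0 ∨ c 1 = 0) ∧ (c' 2 = 0 ∨ c 2 = 0) ∧
          (c' 3 = 0 ∨ c 3 = 0) ∧ (c' 4 = 0 ∨ c 4 = 0) ∧ (c' 5 = 0 ∨ c 5 = 0) := by
        simpa only [or_comm] using hsplit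
      rcases counts_of_unsplit hs h5' h2 hc₂ hc₁ hadd' hsplit' with
        ⟨g1, g2, g3, g4⟩ | ⟨g0, g1, g2, g3, g4⟩
      · exact Or.inr (Or.inl ⟨⟨g1, g2, h5'⟩, g3, g4, h2⟩)
      · exact Or.inr (Or.inr ⟨g0, Or.inr ⟨⟨g1, g2, h5'⟩, h2, g3, g4⟩⟩)
  have hblock : ∀ B B' : Finset α, B ⊆ β.ground →
      (∀ t, β.count B t + β.count B' t = ![β.A.card, β.B.card, k, β.D.card, β.E.card, k] t) →
      ∀ u v : Finset (Fin 6), Disjoint u v → (∀ t ∉ u, β.count B t = 0) →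
      (∀ t ∉ v, β.count B' t = 0) → B = β.blocks u := by
    intro B B' hB hBB' u v huv hu hv
    refine β.eq_blocks_of_count hB u hu fun t ht ↦ ?_
    have h1 := hBB' t
    rw [hv t (Finset.disjoint_left.1 huv ht), add_zero] at h1
    rw [h1]
    obtain ⟨-, -, -, -, -, -, h7, h8⟩ := β.sizes
    fin_cases t <;> simp [block, h7, h8]
  have hadd' := h.symm.count_add_count
  rcases hcases with ⟨ha, hb⟩ | ⟨ha, hb⟩ | ⟨hbal, ⟨ha, hb⟩ | ⟨ha, hb⟩⟩
  · left
    rw [hblock B₁ B₂ hg₁ hadd _ _ (by decide) ha hb, hblock B₂ B₁ hg₂ hadd' _ _ (by decide) hb ha]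
  · left
    rw [hblock B₂ B₁ hg₂ hadd' _ _ (by decide) ha hb, hblock B₁ B₂ hg₁ hadd _ _ (by decide) hb ha,
      Sym2.eq_swap]
  · refine Or.inr ⟨hbal, ?_⟩
    rw [hblock B₁ B₂ hg₁ hadd _ _ (by decide) ha hb, hblock B₂ B₁ hg₂ hadd' _ _ (by decide) hb ha]
  · refine Or.inr ⟨hbal, ?_⟩
    rw [hblock B₂ B₁ hg₂ hadd' _ _ (by decide) ha hb, hblock B₁ B₂ hg₁ hadd _ _ (by decide) hb ha,
      Sym2.eq_swap]

end BetaTuple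

theorem Matroid.exists_isExchangeOrdering_symm {α : Type*} {M : Matroid α} {k : ℕ} {B₁ B₂ : Set α}
    (h : ∃ σ : α → α, M.IsExchangeOrdering k B₁ B₂ σ) :
    ∃ σ : α → α, M.IsExchangeOrdering k B₂ B₁ σ := by
  obtain ⟨σ, hσ, h⟩ := h
  obtain ⟨τ, hτ, hinv⟩ := SwapPair.exists_inverse hσ
  refine ⟨τ, hτ, fun X hX hXk ↦ ?_⟩
  have hστ : σ '' (τ '' X) = X := by
    rw [Set.image_image, Set.image_congr (fun x hx ↦ hinv.2 (hX hx)), Set.image_id']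
  have := h (τ '' X) ((Set.image_mono hX).trans hτ.image_eq.subset)
    ((Set.encard_image_le _ _).trans hXk)
  rw [hστ] at this
  exact this.symm

theorem Matroid.StronglyBaseOrderable.kBaseOrderable {α : Type*} {M : Matroid α}
    (h : M.StronglyBaseOrderable) (k : ℕ) : M.KBaseOrderable k := by
  intro B₁ B₂ h₁ h₂
  obtain ⟨σ, hσ, hex⟩ := h B₁ B₂ h₁ h₂
  exact ⟨σ, hσ, fun X hX _ ↦ hex X hX⟩

namespace BetaTuple

variable {α : Type*} [DecidableEq α] {k : ℕ}

/-! ### The pair `A ∪ B ∪ C`, `D ∪ E ∪ F` -/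

theorem mem_blocks (β : BetaTuple α k) {x : α} {t : Fin 6} (hx : x ∈ β.block t)
    (u : Finset (Fin 6)) : x ∈ β.blocks u ↔ t ∈ u := by
  refine ⟨fun h ↦ ?_, fun h ↦ Finset.mem_biUnion.2 ⟨t, h, hx⟩⟩
  obtain ⟨s, hs, hxs⟩ := Finset.mem_biUnion.1 h
  by_contra ht
  exact Finset.disjoint_left.1 (β.disjoint_block (s := s) (t := t)
    (by rintro rfl; exact ht hs)) hxs hx

theorem card_blocks (β : BetaTuple α k) (u : Finset (Fin 6)) :
    (β.blocks u).card = ∑ t ∈ u, (β.block t).card :=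
  Finset.card_biUnion fun _ _ _ _ h ↦ β.disjoint_block h

/-- The blocks in `u` already fill the rank of the flat, so one more element of that flat exceeds
it. -/
theorem not_indep_insert_blocks (β : BetaTuple α k) (i : Fin 7) {u : Finset (Fin 6)}
    (hu : u ⊆ flatIndex i) (hr : β.rank i ≤ (β.blocks u).card) {x : α} {t : Fin 6}
    (hx : x ∈ β.block t) (htu : t ∉ u) (hti : t ∈ flatIndex i) {I : Set α}
    (hI : insert x (β.blocks u : Set α) ⊆ I) : ¬ β.matroid.Indep I := by
  intro h
  have h1 := h.subset hI
  rw [← Finset.coe_insert, indep_coe_iff] at h1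
  have h2 := h1.2 i
  rw [flat_eq_blocks, Finset.inter_eq_left.2, Finset.card_insert_of_notMem] at h2
  · omega
  · rwa [β.mem_blocks hx]
  · exact Finset.insert_subset ((β.mem_blocks hx _).2 hti)
      (Finset.biUnion_subset_biUnion_of_subset_left _ hu)

theorem not_exists_isExchangeOrdering (hk : 2 ≤ k) (β : BetaTuple α k) :
    ¬ ∃ σ : α → α, β.matroid.IsExchangeOrdering k (β.blocks {0, 1, 2} : Set α)
      (β.blocks {3, 4, 5} : Set α) σ := by
  rintro ⟨σ, hσ, hex⟩
  obtain ⟨h1, h2, h3, h4, h5, h6, h7, h8⟩ := β.sizes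
  have hsingle : ∀ x ∈ β.blocks {0, 1, 2},
      β.matroid.IsBase (((β.blocks {0, 1, 2} : Set α) \ {x}) ∪ {σ x}) ∧
      β.matroid.IsBase (((β.blocks {3, 4, 5} : Set α) \ {σ x}) ∪ {x}) := by
    intro x hx
    have := hex {x} (by simpa using hx)
      (by rw [Set.encard_singleton]; exact_mod_cast (by omega : 1 ≤ k))
    rwa [Set.image_singleton] at this
  have hsub : ∀ {u v : Finset (Fin 6)} {x y : α} {s : Fin 6}, x ∈ β.block s → s ∉ v → v ⊆ u →
      insert y (β.blocks v : Set α) ⊆ ((β.blocks u : Set α) \ {x}) ∪ {y} := by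
    intro u v x y s hx hs hvu
    rintro z (rfl | hz)
    · exact Or.inr rfl
    · refine Or.inl ⟨Finset.biUnion_subset_biUnion_of_subset_left _ hvu hz, ?_⟩
      rintro rfl
      exact hs ((β.mem_blocks hx v).1 hz)
  have hF : ∀ x ∈ β.blocks {0, 1}, σ x ∈ β.F := by
    intro x hx
    have hx' : x ∈ β.blocks {0, 1, 2} :=
      Finset.biUnion_subset_biUnion_of_subset_left _ (by decide) hx
    obtain ⟨hb1, hb2⟩ := hsingle x hx'
    have hy : σ x ∈ β.blocks {3, 4, 5} := hσ.mapsTo hx'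
    obtain ⟨s, hs, hxs⟩ := Finset.mem_biUnion.1 hx
    obtain ⟨t, ht, hyt⟩ := Finset.mem_biUnion.1 hy
    by_contra hcon
    have ht5 : t ≠ 5 := by rintro rfl; exact hcon hyt
    have hr : β.rank 2 ≤ (β.blocks {1, 2}).card ∧ β.rank 3 ≤ (β.blocks {0, 2}).card ∧
        β.rank 4 ≤ (β.blocks {4, 5}).card ∧ β.rank 5 ≤ (β.blocks {3, 5}).card := by
      simp [card_blocks, rank, block, h7, h8, add_comm]
    simp only [Finset.mem_insert, Finset.mem_singleton] at hs ht
    -- If `x ∈ A` is paired with `D`, the second base receives `E ∪ F ∪ {x}`, too large in `F ∪ E ∪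
    -- A`. If it is paired with `E`, the first base receives `B ∪ C ∪ {σ x}`, too large in `C ∪ B ∪
    -- E`. The cases of `x ∈ B` are analogous, with `C ∪ A ∪ D` and `F ∪ D ∪ B`.
    rcases hs with rfl | rfl <;> rcases ht with rfl | rfl | rfl
    · exact β.not_indep_insert_blocks 4 (u := {4, 5}) (by decide) hr.2.2.1 hxs (by decide)
        (by decide) (hsub hyt (by decide) (by decide)) hb2.indep
    · exact β.not_indep_insert_blocks 2 (u := {1, 2}) (by decide) hr.1 hyt (by decide)
        (by decide) (hsub hxs (by decide) (by decide)) hb1.indep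
    · exact ht5 rfl
    · exact β.not_indep_insert_blocks 3 (u := {0, 2}) (by decide) hr.2.1 hyt (by decide)
        (by decide) (hsub hxs (by decide) (by decide)) hb1.indep
    · exact β.not_indep_insert_blocks 5 (u := {3, 5}) (by decide) hr.2.2.2 hxs (by decide)
        (by decide) (hsub hyt (by decide) (by decide)) hb2.indep
    · exact ht5 rfl
  have hAB : (β.blocks {0, 1}).card = k := by simp [card_blocks, block, h5]
  have himg : (β.blocks {0, 1}).image σ = β.F := by
    refine Finset.eq_of_subset_of_card_le (Finset.image_subset_iff.2 hF) ?_
    rw [Finset.card_image_of_injOn, hAB, h8]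
    exact hσ.injOn.mono (Finset.coe_subset.2
      (Finset.biUnion_subset_biUnion_of_subset_left _ (by decide)))
  have hCsub : (β.C : Set α) ⊆ β.blocks {0, 1, 2} :=
    Finset.coe_subset.2 (Finset.subset_biUnion_of_mem β.block (x := 2) (by decide))
  -- As `A ∪ B` fills `F`, the image of `C` avoids `F`. Exchanging the `k` elements of `C` leaves
  -- `2k` elements in a flat of rank `2k - 1`.
  have hbase := (hex β.C hCsub (by rw [Set.encard_coe_eq_coe_finsetCard, h7])).1
  have hle : ((β.blocks {0, 1, 2} : Set α) \ β.C) ∪ σ '' β.C ⊆ (β.flat 1 : Set α) := by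
    rw [flat_eq_blocks]
    rintro z (⟨hz, hzC⟩ | ⟨x, hx, rfl⟩)
    · obtain ⟨t, ht, hzt⟩ := Finset.mem_biUnion.1 hz
      refine Finset.mem_coe.2 ((β.mem_blocks hzt _).2 ?_)
      simp only [Finset.mem_insert, Finset.mem_singleton] at ht
      rcases ht with rfl | rfl | rfl
      · decide
      · decide
      · exact absurd hzt hzC
    · have hy : σ x ∈ β.blocks {3, 4, 5} := hσ.mapsTo (hCsub hx)
      obtain ⟨t, ht, hyt⟩ := Finset.mem_biUnion.1 hy
      refine Finset.mem_coe.2 ((β.mem_blocks hyt _).2 ?_)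
      simp only [Finset.mem_insert, Finset.mem_singleton] at ht
      rcases ht with rfl | rfl | rfl
      · decide
      · decide
      · exfalso
        have h9 : σ x ∈ β.F := hyt
        rw [← himg, Finset.mem_image] at h9
        obtain ⟨z, hz, hzx⟩ := h9
        have := hσ.injOn (Finset.mem_coe.2
          (Finset.biUnion_subset_biUnion_of_subset_left β.block (by decide) hz)) (hCsub hx) hzx
        subst this
        exact absurd ((β.mem_blocks (t := 2) hx {0, 1}).1 hz) (by decide)
  have hfin := β.matroid.set_finite _ hbase.subset_ground
  generalize ((β.blocks {0, 1, 2} : Set α) \ β.C) ∪ σ '' β.C = J at *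
  lift J to Finset α using hfin
  have hcard := β.card_of_isBase hbase
  have hlt := (β.indep_coe_iff.1 hbase.indep).2 1
  rw [Finset.inter_eq_left.2 (by exact_mod_cast hle), hcard] at hlt
  have : β.rank 1 = 2 * k - 1 := rfl
  omega

/-- Elements lost from `A ∪ B` are replaced in `F`, which keeps the bounds on `A ∪ D ∪ F` and `B ∪ E
∪ F`. Elements lost from `C` are replaced in `D ∪ E`, with at most `|E|` of them in `E` and at most
`|D|` in `D`, which keeps the other two. The bound on `C ∪ F` fails only for `X = C`. -/
theorem isBase_sdiff_union_image (β : BetaTuple α k) {σ : α → α}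
    (hσ : Set.BijOn σ (β.blocks {0, 1, 2} : Set α) (β.blocks {3, 4, 5} : Set α))
    (hσ₁ : Set.BijOn σ (β.blocks {0, 1} : Set α) (β.F : Set α)) {X : Finset α}
    (hX : X ⊆ β.blocks {0, 1, 2}) (hne : X ≠ β.C) :
    β.matroid.IsBase (((β.blocks {0, 1, 2} \ X) ∪ X.image σ : Finset α) : Set α) := by
  obtain ⟨h1, h2, h3, h4, h5, h6, h7, h8⟩ := β.sizes
  have hY : X.image σ ⊆ β.blocks {3, 4, 5} := by
    rw [Finset.image_subset_iff]
    exact fun x hx ↦ hσ.mapsTo (hX hx)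
  set Y := (β.blocks {0, 1, 2} \ X) ∪ X.image σ with hYdef
  have hd : Disjoint (β.blocks {0, 1, 2} \ X) (X.image σ) :=
    (β.disjoint_blocks (by decide)).mono Finset.sdiff_subset hY
  have hYg : Y ⊆ β.ground := Finset.union_subset
    (Finset.sdiff_subset.trans (β.blocks_subset_ground _)) (hY.trans (β.blocks_subset_ground _))
  have hcardY : Y.card = 2 * k := by
    rw [hYdef, Finset.card_union_of_disjoint hd,
      Finset.card_image_of_injOn (hσ.injOn.mono (Finset.coe_subset.2 hX)),
      Finset.card_sdiff_add_card_eq_card hX, β.blocks_ABC_indep.2]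
  have hlow : ∀ t ∈ ({0, 1, 2} : Finset (Fin 6)),
      β.count Y t + β.count X t = (β.block t).card := by
    intro t ht
    have : Y ∩ β.block t = β.block t \ X := by
      ext z
      simp only [hYdef, Finset.mem_inter, Finset.mem_union, Finset.mem_sdiff]
      refine ⟨fun ⟨hz, hzt⟩ ↦ ⟨hzt, fun hzX ↦ ?_⟩, fun ⟨hzt, hzX⟩ ↦
        ⟨Or.inl ⟨(β.mem_blocks hzt _).2 ht, hzX⟩, hzt⟩⟩
      rcases hz with hz | hz
      · exact hz.2 hzX
      · exact Finset.disjoint_left.1 (β.disjoint_blocks (by decide)) (hX hzX) (hY hz)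
    rw [count, count, this, Finset.inter_comm X, Finset.card_sdiff_add_card_inter]
  have hhigh : β.count Y 5 = β.count X 0 + β.count X 1 := by
    have : Y ∩ β.block 5 = (X ∩ β.blocks {0, 1}).image σ := by
      ext z
      simp only [hYdef, Finset.mem_inter, Finset.mem_union, Finset.mem_sdiff, Finset.mem_image]
      constructor
      · rintro ⟨hz | ⟨x, hx, rfl⟩, hz5⟩
        · exact absurd ((β.mem_blocks hz5 _).1 hz.1) (by decide)
        · obtain ⟨y, hy, hyx⟩ := hσ₁.surjOn (show σ x ∈ (β.F : Set α) from hz5)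
          have := hσ.injOn (Finset.mem_coe.2
            (Finset.biUnion_subset_biUnion_of_subset_left β.block (by decide) hy)) (hX hx) hyx
          subst this
          exact ⟨y, ⟨hx, hy⟩, rfl⟩
      · rintro ⟨x, ⟨hxX, hx⟩, rfl⟩
        exact ⟨Or.inr ⟨x, hxX, rfl⟩, hσ₁.mapsTo hx⟩
    rw [count, this, Finset.card_image_of_injOn, card_inter_blocks, Finset.sum_pair (by decide)]
    exact hσ₁.injOn.mono (Finset.coe_subset.2 Finset.inter_subset_right)
  have hsum := β.card_eq_sum_count hYg
  have hle := β.count_le Y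
  have hXC : ¬ (β.count X 0 = 0 ∧ β.count X 1 = 0 ∧ k ≤ β.count X 2) := by
    rintro ⟨g0, g1, g2⟩
    apply hne
    have := β.eq_blocks_of_count (hX.trans (β.blocks_subset_ground _)) {2} ?_ ?_
    · simpa [blocks, block] using this
    · intro t ht
      have hX0 : ∀ s ∉ ({0, 1, 2} : Finset (Fin 6)), β.count X s = 0 := by
        intro s hs
        rw [count, Finset.card_eq_zero, ← Finset.disjoint_iff_inter_eq_empty,
          Finset.disjoint_left]
        exact fun z hz hzs ↦ hs ((β.mem_blocks hzs _).1 (hX hz))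
      fin_cases t
      · exact g0
      · exact g1
      · simp at ht
      all_goals exact hX0 _ (by decide)
    · intro t ht
      rw [Finset.mem_singleton] at ht
      subst ht
      exact h7.le.trans g2
  have l0 := hlow 0 (by decide)
  have l1 := hlow 1 (by decide)
  have l2 := hlow 2 (by decide)
  simp only [block, Matrix.cons_val] at l0 l1 l2
  rw [hcardY] at hsum
  simp [Fin.sum_univ_succ] at hsum
  refine β.isBase_coe_iff.2 ⟨hYg, ?_⟩
  rw [IsBaseCount]
  refine ⟨by omega, by omega, by omega, by omega, by omega, by omega⟩

theorem exists_isExchangeOrdering_pred (hk : 2 ≤ k) (β : BetaTuple α k) :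
    ∃ σ : α → α, β.matroid.IsExchangeOrdering (k - 1) (β.blocks {0, 1, 2} : Set α)
      (β.blocks {3, 4, 5} : Set α) σ := by
  obtain ⟨h1, h2, h3, h4, h5, h6, h7, h8⟩ := β.sizes
  have hAB : (β.blocks {0, 1}).card = k := by simp [card_blocks, block, h5]
  have hDE : (β.blocks {3, 4}).card = k := by simp [card_blocks, block, h6]
  obtain ⟨x₀, -⟩ := Finset.card_pos.1 h1
  have : Nonempty α := ⟨x₀⟩
  obtain ⟨f, hf⟩ := (β.blocks {0, 1}).finite_toSet.exists_bijOn_of_encard_eq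
    (t := (β.F : Set α)) (by simp only [Set.encard_coe_eq_coe_finsetCard, hAB, h8])
  obtain ⟨g, hg⟩ := β.C.finite_toSet.exists_bijOn_of_encard_eq
    (t := (β.blocks {3, 4} : Set α)) (by simp only [Set.encard_coe_eq_coe_finsetCard, hDE, h7])
  let σ : α → α := fun x ↦ if x ∈ β.C then g x else f x
  have hdAB : ∀ x ∈ β.blocks {0, 1}, x ∉ β.C := fun x hx hxC ↦
    absurd ((β.mem_blocks (t := 2) hxC _).1 hx) (by decide)
  have hσ₁ : Set.BijOn σ (β.blocks {0, 1} : Set α) (β.F : Set α) :=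
    hf.congr fun x hx ↦ (if_neg (hdAB x hx)).symm
  have hσ₂ : Set.BijOn σ (β.C : Set α) (β.blocks {3, 4} : Set α) :=
    hg.congr fun x hx ↦ (if_pos (Finset.mem_coe.1 hx)).symm
  have e1 : (β.blocks {0, 1} : Set α) ∪ β.C = β.blocks {0, 1, 2} := by
    rw [← Finset.coe_union]
    congr 1
    simp [blocks, block, Finset.union_assoc]
  have e2 : (β.F : Set α) ∪ β.blocks {3, 4} = β.blocks {3, 4, 5} := by
    rw [← Finset.coe_union, Finset.union_comm]
    congr 1
    simp [blocks, block, Finset.union_assoc]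
  have hσ : Set.BijOn σ (β.blocks {0, 1, 2} : Set α) (β.blocks {3, 4, 5} : Set α) := by
    rw [← e1, ← e2]
    refine hσ₁.union hσ₂ ?_
    have hdF : ∀ x ∈ (β.blocks {0, 1} : Set α), ∀ y ∈ (β.C : Set α), σ x ≠ σ y := by
      intro x hx y hy hxy
      exact absurd ((β.mem_blocks (t := 5) (hσ₁.mapsTo hx) _).1
        (hxy ▸ hσ₂.mapsTo hy : σ x ∈ β.blocks {3, 4})) (by decide)
    rintro x (hx | hx) y (hy | hy) hxy
    · exact hσ₁.injOn hx hy hxy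
    · exact absurd hxy (hdF x hx y hy)
    · exact absurd hxy.symm (hdF y hy x hx)
    · exact hσ₂.injOn hx hy hxy
  refine ⟨σ, hσ, fun X hX hXk ↦ ?_⟩
  lift X to Finset α using (β.blocks {0, 1, 2}).finite_toSet.subset hX
  rw [Set.encard_coe_eq_coe_finsetCard, Nat.cast_le] at hXk
  rw [Finset.coe_subset] at hX
  have b1 := β.isBase_sdiff_union_image hσ hσ₁ hX (by rintro rfl; omega)
  -- The reverse exchange of `X` is the forward exchange of its complement, which has at least `k +
  -- 1` elements and so is not `C`.
  have b2 := β.isBase_sdiff_union_image hσ hσ₁ (X := β.blocks {0, 1, 2} \ X)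
    Finset.sdiff_subset (by
      intro h
      have := Finset.card_sdiff_add_card_eq_card hX
      rw [h, β.blocks_ABC_indep.2] at this
      omega)
  push_cast at b1 b2
  refine ⟨b1, ?_⟩
  rw [hσ.injOn.image_sdiff_subset (Finset.coe_subset.2 hX), hσ.image_eq,
    Set.sdiff_sdiff_cancel_left (Finset.coe_subset.2 hX), Set.union_comm] at b2
  exact b2

theorem blocks_swapped (β : BetaTuple α k) :
    β.swapped.blocks {0, 1, 2} = β.blocks {3, 4, 2} ∧
      β.swapped.blocks {3, 4, 5} = β.blocks {0, 1, 5} := by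
  simp [blocks, block, swapped]

theorem kBaseOrderable_pred (hk : 2 ≤ k) (β : BetaTuple α k) :
    β.matroid.KBaseOrderable (k - 1) := by
  intro B₁ B₂ h₁ h₂
  by_cases h : SwapPair β.matroid.IsBase B₁ B₂
  · exact exists_isExchangeOrdering_of_swapPair _ h
  have key : ∀ S T : Set α, s(B₁, B₂) = s(S, T) →
      (∃ σ : α → α, β.matroid.IsExchangeOrdering (k - 1) S T σ) →
      ∃ σ : α → α, β.matroid.IsExchangeOrdering (k - 1) B₁ B₂ σ := by
    intro S T he hex
    rcases Sym2.eq_iff.1 he with ⟨rfl, rfl⟩ | ⟨rfl, rfl⟩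
    · exact hex
    · exact exists_isExchangeOrdering_symm hex
  rcases β.eq_blocks_of_not_swapPair hk h₁ h₂ h with he | ⟨⟨g1, g2, g3, g4⟩, he⟩
  · exact key _ _ he (β.exists_isExchangeOrdering_pred hk)
  · refine key _ _ he ?_
    -- The second exceptional pair is the first one of `β.swapped`, which has the same matroid when
    -- the four sizes agree.
    have := β.swapped.exists_isExchangeOrdering_pred hk
    rwa [β.matroid_swapped (by omega) (by omega) (by omega), β.blocks_swapped.1,
      β.blocks_swapped.2] at this

theorem not_kBaseOrderable (hk : 2 ≤ k) (β : BetaTuple α k) : ¬ β.matroid.KBaseOrderable k :=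
  fun h ↦ β.not_exists_isExchangeOrdering hk (h _ _ β.blocks_ABC_isBase β.blocks_DEF_isBase)

theorem blocks_injective (β : BetaTuple α k) : Function.Injective β.blocks := by
  intro u v huv
  ext t
  obtain ⟨x, hx⟩ : (β.block t).Nonempty := by
    apply β.nonempty
    fin_cases t <;> simp [block]
  rw [← β.mem_blocks hx, huv, β.mem_blocks hx]

theorem mem_pairsWithoutExchangeOrdering (hk : 2 ≤ k) (β : BetaTuple α k) :
    s((β.blocks {0, 1, 2} : Set α), (β.blocks {3, 4, 5} : Set α)) ∈
      β.matroid.pairsWithoutExchangeOrdering k :=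
  ⟨_, _, rfl, β.blocks_ABC_isBase, β.blocks_DEF_isBase, β.not_exists_isExchangeOrdering hk⟩

theorem eq_of_mem_pairsWithoutExchangeOrdering (hk : 2 ≤ k) (β : BetaTuple α k)
    {p : Sym2 (Set α)} (hp : p ∈ β.matroid.pairsWithoutExchangeOrdering k) :
    p = s((β.blocks {0, 1, 2} : Set α), (β.blocks {3, 4, 5} : Set α)) ∨
      β.Balanced ∧ p = s((β.blocks {3, 4, 2} : Set α), (β.blocks {0, 1, 5} : Set α)) := by
  obtain ⟨B₁, B₂, rfl, h₁, h₂, hn⟩ := hp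
  exact β.eq_blocks_of_not_swapPair hk h₁ h₂ fun h ↦
    hn (exists_isExchangeOrdering_of_swapPair k h)

theorem encard_pairsWithoutExchangeOrdering_of_balanced (hk : 2 ≤ k) (β : BetaTuple α k)
    (hβ : β.Balanced) : (β.matroid.pairsWithoutExchangeOrdering k).encard = 2 := by
  have h2 := β.swapped.mem_pairsWithoutExchangeOrdering hk
  have hβ' := hβ
  obtain ⟨g1, g2, g3, g4⟩ := hβ'
  rw [β.matroid_swapped (by omega) (by omega) (by omega), β.blocks_swapped.1,
    β.blocks_swapped.2] at h2
  rw [Set.encard_eq_two]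
  refine ⟨_, _, ?_, Set.Subset.antisymm (fun p hp ↦ ?_)
    (Set.insert_subset (β.mem_pairsWithoutExchangeOrdering hk) (Set.singleton_subset_iff.2 h2))⟩
  · rw [ne_eq, Sym2.eq_iff]
    simp only [Finset.coe_inj, β.blocks_injective.eq_iff]
    decide
  · exact (β.eq_of_mem_pairsWithoutExchangeOrdering hk hp).imp_right And.right

theorem encard_pairsWithoutExchangeOrdering_of_not_balanced (hk : 2 ≤ k) (β : BetaTuple α k)
    (hβ : ¬ β.Balanced) : (β.matroid.pairsWithoutExchangeOrdering k).encard = 1 := by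
  rw [Set.encard_eq_one]
  refine ⟨_, Set.Subset.antisymm (fun p hp ↦ ?_)
    (Set.singleton_subset_iff.2 (β.mem_pairsWithoutExchangeOrdering hk))⟩
  exact (β.eq_of_mem_pairsWithoutExchangeOrdering hk hp).resolve_right fun h ↦ hβ h.1

end BetaTuple

/-! ### Matroids determined by their ranked cyclic flats -/

namespace Matroid

variable {α : Type*} {M N : Matroid α}

theorem IsCircuit.isCyclicFlat_closure {C : Set α} (hC : M.IsCircuit C) :
    M.IsCyclicFlat (M.closure C) := by
  refine ⟨M.isFlat_closure C, {K | M.IsCircuit K ∧ K ⊆ M.closure C}, fun K hK ↦ hK.1,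
    Set.Subset.antisymm (fun x hx ↦ ?_) (Set.sUnion_subset fun K hK ↦ hK.2)⟩
  have hCcl := M.subset_closure C hC.subset_ground
  by_cases hxC : x ∈ C
  · exact ⟨C, ⟨hC, hCcl⟩, hxC⟩
  · obtain ⟨K, hKC, hK, hxK⟩ := exists_isCircuit_of_mem_closure hx hxC
    exact ⟨K, ⟨hK, hKC.trans (Set.insert_subset hx hCcl)⟩, hxK⟩

/-- A finite matroid is determined by its cyclic flats and their ranks. -/
theorem indep_iff_of_isCyclicFlat [M.RankFinite] {I : Set α} (hI : I ⊆ M.E) :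
    M.Indep I ↔ ∀ Z, M.IsCyclicFlat Z → (I ∩ Z).encard ≤ M.eRk Z := by
  refine ⟨fun h Z _ ↦ (h.inter_right Z).encard_le_eRk_of_subset Set.inter_subset_right,
    fun h ↦ ?_⟩
  by_contra hn
  obtain ⟨C, hCI, hC⟩ := (((not_indep_iff hI).1 hn)).exists_isCircuit_subset
  -- A circuit contained in `I` violates the bound at its own closure, a cyclic flat of rank `|C| -
  -- 1`.
  have h1 := h _ hC.isCyclicFlat_closure
  have h2 : C ⊆ I ∩ M.closure C := Set.subset_inter hCI (M.subset_closure C hC.subset_ground)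
  have h3 := (Set.encard_le_encard h2).trans h1
  rw [eRk_closure_eq, ← hC.eRk_add_one_eq] at h3
  have h4 : M.eRk C ≠ ⊤ := ((M.eRk_le_eRank C).trans_lt (eRank_lt_top_iff.2 inferInstance)).ne
  exact absurd h3 (not_le.2 (ENat.lt_add_one_iff h4 |>.2 le_rfl))

end Matroid

namespace BetaTuple

variable {α : Type*} [DecidableEq α] {k : ℕ}

/-! ### The cyclic flats of `M_β` -/

theorem rank_lt (β : BetaTuple α k) {i : Fin 7} (h0 : i ≠ 0) (h6 : i ≠ 6) :
    β.rank i < 2 * k ∧ β.rank i < (β.flat i).card := by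
  obtain ⟨g1, g2, g3, g4, g5, g6, g7, g8⟩ := β.sizes
  rw [flat_eq_blocks, card_blocks]
  fin_cases i <;>
    first
    | exact absurd rfl h0
    | exact absurd rfl h6
    | simp [rank, flatIndex, block, -Finset.card_pos]; omega

theorem flat_subset_ground (β : BetaTuple α k) (i : Fin 7) : β.flat i ⊆ β.ground := by
  rw [flat_eq_blocks]; exact β.blocks_subset_ground _

theorem inter_card_add_le_of_ne (β : BetaTuple α k) {i j : Fin 7} (hij : i ≠ j) (hi0 : i ≠ 0)
    (hi6 : i ≠ 6) (hj0 : j ≠ 0) (hj6 : j ≠ 6) :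
    (β.flat i ∩ β.flat j).card + 2 * k ≤ β.rank i + β.rank j := by
  rcases lt_or_gt_of_ne hij with h | h
  · exact β.inter_card_add_le hi0 hi6 h hj6
  · rw [Finset.inter_comm, add_comm (β.rank i)]
    exact β.inter_card_add_le hj0 hj6 h hi6

/-- Small sets that contain at most one element outside one of the flats are independent. -/
theorem indep_of_card_sdiff_flat_le_one (β : BetaTuple α k) {i : Fin 7} (h0 : i ≠ 0) (h6 : i ≠ 6)
    {I : Finset α} (hI : I ⊆ β.ground) (h1 : (I \ β.flat i).card ≤ 1)
    (hr : (I ∩ β.flat i).card ≤ β.rank i) : β.matroid.Indep (I : Set α) := by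
  have hlt := (β.rank_lt h0 h6).1
  have hcard := Finset.card_inter_add_card_sdiff I (β.flat i)
  refine β.indep_coe_iff.2 ⟨hI, fun j ↦ ?_⟩
  by_cases hj0 : j = 0
  · subst hj0
    have h2 : (I ∩ β.flat 0).card ≤ I.card := Finset.card_le_card Finset.inter_subset_left
    have h3 : β.rank 0 = 2 * k := rfl
    omega
  by_cases hj6 : j = 6
  · subst hj6
    have h2 : β.flat 6 = ∅ := rfl
    rw [h2, Finset.inter_empty]
    exact Nat.zero_le _
  by_cases hij : i = j
  · rwa [← hij]
  -- Here `|I ∩ Z_j| ≤ |Z_i ∩ Z_j| + 1 ≤ r_i + r_j - 2k + 1 ≤ r_j`, the last step because `r_i <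
  -- 2k`.
  have h2 := β.inter_card_add_le_of_ne hij h0 h6 hj0 hj6
  have h3 : I ∩ β.flat j ⊆ (β.flat i ∩ β.flat j) ∪ (I \ β.flat i) := by
    intro x hx
    simp only [Finset.mem_inter, Finset.mem_union, Finset.mem_sdiff] at *
    tauto
  have h4 := (Finset.card_le_card h3).trans (Finset.card_union_le _ _)
  omega

/-- A basis of the flat avoiding a given `x` yields a circuit through `x` inside the flat. This
makes the flat cyclic. -/
theorem exists_indep_subset_flat (β : BetaTuple α k) (i : Fin 7) {x : α} (hx : x ∈ β.flat i) :
    ∃ I : Finset α, I ⊆ β.flat i ∧ x ∉ I ∧ β.matroid.Indep (I : Set α) ∧ I.card = β.rank i := by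
  by_cases h0 : i = 0
  · subst h0
    by_cases h : x ∈ β.blocks {0, 1, 2}
    · refine ⟨β.blocks {3, 4, 5}, β.blocks_subset_ground _,
        Finset.disjoint_left.1 (β.disjoint_blocks (by decide)) h, β.blocks_DEF_isBase.indep,
        β.card_of_isBase β.blocks_DEF_isBase⟩
    · exact ⟨β.blocks {0, 1, 2}, β.blocks_subset_ground _, h, β.blocks_ABC_indep⟩
  by_cases h6 : i = 6
  · subst h6
    exact absurd hx (Finset.notMem_empty x)
  obtain ⟨I, hIsub, hI⟩ := Finset.exists_subset_card_eq (s := (β.flat i).erase x) (n := β.rank i)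
    (by have := (β.rank_lt h0 h6).2; rw [Finset.card_erase_of_mem hx]; omega)
  have hIf : I ⊆ β.flat i := hIsub.trans (Finset.erase_subset _ _)
  refine ⟨I, hIf, fun h ↦ Finset.notMem_erase x _ (hIsub h),
    β.indep_of_card_sdiff_flat_le_one h0 h6 (hIf.trans (β.flat_subset_ground i)) ?_ ?_, hI⟩
  · rw [Finset.sdiff_eq_empty_iff_subset.2 hIf]
    exact Nat.zero_le _
  · rw [Finset.inter_eq_left.2 hIf, hI]

theorem eRk_flat (β : BetaTuple α k) (i : Fin 7) :
    β.matroid.eRk (β.flat i : Set α) = (β.rank i : ℕ∞) := by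
  refine le_antisymm (eRk_le_iff.2 fun I hIf hI ↦ ?_) ?_
  · have := (β.matroid_indep_iff.1 hI).2 i
    rwa [Set.inter_eq_left.2 hIf] at this
  · by_cases h6 : i = 6
    · subst h6
      exact bot_le
    · obtain ⟨x, hx⟩ : (β.flat i).Nonempty := by
        by_cases h0 : i = 0
        · subst h0
          exact (Finset.card_pos.1 β.sizes.1).mono (β.flat_subset_ground 1 |>.trans' (by
            simp only [flat, Matrix.cons_val]; intro x; simp; tauto))
        · exact Finset.card_pos.1 ((Nat.zero_le _).trans_lt (β.rank_lt h0 h6).2)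
      obtain ⟨I, hIf, -, hI, hcard⟩ := β.exists_indep_subset_flat i hx
      rw [← hcard, ← Set.encard_coe_eq_coe_finsetCard]
      exact hI.encard_le_eRk_of_subset (Finset.coe_subset.2 hIf)

theorem isBasis_flat (β : BetaTuple α k) {i : Fin 7} {I : Finset α} (hIf : I ⊆ β.flat i)
    (hI : β.matroid.Indep (I : Set α)) (hcard : I.card = β.rank i) :
    β.matroid.IsBasis (I : Set α) (β.flat i : Set α) :=
  hI.isBasis_of_eRk_ge I.finite_toSet (Finset.coe_subset.2 hIf)
    (by rw [eRk_flat, hI.eRk_eq_encard, Set.encard_coe_eq_coe_finsetCard, hcard])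
    (Finset.coe_subset.2 (β.flat_subset_ground i))

theorem isFlat_flat (hk : 2 ≤ k) (β : BetaTuple α k) (i : Fin 7) :
    β.matroid.IsFlat (β.flat i : Set α) := by
  by_cases h0 : i = 0
  · subst h0
    exact β.matroid.ground_isFlat
  rw [isFlat_iff_closure_eq]
  refine Set.Subset.antisymm (fun x hx ↦ ?_)
    (β.matroid.subset_closure _ (Finset.coe_subset.2 (β.flat_subset_ground i)))
  have hxE : x ∈ β.ground := Finset.mem_coe.1 (mem_ground_of_mem_closure hx)
  by_cases h6 : i = 6
  · subst h6
    have h2 : β.flat 6 = ∅ := rfl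
    rw [h2, Finset.coe_empty, closure_empty] at hx
    exact absurd hx (β.isNonloop_of_mem_ground hk hxE).not_isLoop
  by_contra hxf
  obtain ⟨y, hy⟩ : (β.flat i).Nonempty :=
    Finset.card_pos.1 ((Nat.zero_le _).trans_lt (β.rank_lt h0 h6).2)
  obtain ⟨I, hIf, -, hI, hcard⟩ := β.exists_indep_subset_flat i hy
  rw [← (β.isBasis_flat hIf hI hcard).closure_eq_closure] at hx
  have hxI : x ∉ I := fun h ↦ hxf (Finset.mem_coe.2 (hIf h))
  rw [hI.mem_closure_iff_of_notMem (by simpa using hxI), ← Finset.coe_insert] at hx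
  have hxf' : x ∉ β.flat i := hxf
  refine hx.not_indep (β.indep_of_card_sdiff_flat_le_one h0 h6
    (Finset.insert_subset hxE (hIf.trans (β.flat_subset_ground i))) ?_ ?_)
  · rw [Finset.insert_sdiff_of_notMem _ hxf', Finset.sdiff_eq_empty_iff_subset.2 hIf]
    simp
  · rw [Finset.insert_inter_of_notMem hxf', Finset.inter_eq_left.2 hIf, hcard]

theorem isCyclicFlat_flat (hk : 2 ≤ k) (β : BetaTuple α k) (i : Fin 7) :
    β.matroid.IsCyclicFlat (β.flat i : Set α) := by
  refine ⟨β.isFlat_flat hk i, {K | β.matroid.IsCircuit K ∧ K ⊆ β.flat i}, fun K hK ↦ hK.1,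
    Set.Subset.antisymm (fun x hx ↦ ?_) (Set.sUnion_subset fun K hK ↦ hK.2)⟩
  obtain ⟨I, hIf, hxI, hI, hcard⟩ := β.exists_indep_subset_flat i hx
  have hxcl : x ∈ β.matroid.closure (I : Set α) := by
    rw [(β.isBasis_flat hIf hI hcard).closure_eq_closure]
    exact β.matroid.subset_closure _ (Finset.coe_subset.2 (β.flat_subset_ground i)) hx
  obtain ⟨K, hKI, hK, hxK⟩ := exists_isCircuit_of_mem_closure hxcl (by simpa using hxI)
  exact ⟨K, ⟨hK, hKI.trans (Set.insert_subset hx (Finset.coe_subset.2 hIf))⟩, hxK⟩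

/-- A circuit violates the bound of some member of `𝒵`. By minimality it lies inside that member,
and its rank is then large enough to span it. -/
theorem exists_flat_subset_of_isCircuit (hk : 2 ≤ k) (β : BetaTuple α k) {K X : Set α}
    (hK : β.matroid.IsCircuit K) (hKX : K ⊆ X) (hX : β.matroid.IsFlat X) :
    ∃ i, i ≠ 6 ∧ (β.flat i : Set α) ⊆ X := by
  have hn := hK.not_indep
  rw [matroid_indep_iff, not_and, not_forall] at hn
  obtain ⟨i, hi⟩ := hn hK.subset_ground
  rw [not_le] at hi
  have hsub : K ∩ (β.flat i : Set α) = K := by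
    refine hK.eq_of_not_indep_subset (fun h ↦ ?_) Set.inter_subset_left
    have := (β.matroid_indep_iff.1 h).2 i
    rw [Set.inter_assoc, Set.inter_self] at this
    exact absurd hi (not_lt.2 this)
  have hKf : K ⊆ (β.flat i : Set α) := Set.inter_eq_left.1 hsub
  rw [hsub] at hi
  refine ⟨i, ?_, ?_⟩
  · rintro rfl
    have h2 : β.flat 6 = ∅ := rfl
    rw [h2, Finset.coe_empty] at hKf
    exact hK.nonempty.ne_empty (Set.subset_empty_iff.1 hKf)
  · have hle : β.matroid.eRk (β.flat i : Set α) ≤ β.matroid.eRk K := by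
      rw [eRk_flat]
      rw [← hK.eRk_add_one_eq] at hi
      exact Order.lt_add_one_iff_of_not_isMax (not_isMax_iff_ne_top.2 (by
        exact ((β.matroid.eRk_le_eRank K).trans_lt (eRank_lt_top_iff.2 inferInstance)).ne)) |>.1 hi
    have hcl := IsRkFinite.closure_eq_closure_of_subset_of_eRk_ge_eRk
      (β.matroid.isRkFinite_set K) hKf hle
    have h3 := (β.matroid.closure_subset_closure hKX).trans hX.closure.subset
    rw [hcl, (β.isFlat_flat hk i).closure] at h3
    exact h3

theorem eq_flat_of_isCyclicFlat (hk : 2 ≤ k) (β : BetaTuple α k) {X : Set α}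
    (hX : β.matroid.IsCyclicFlat X) : ∃ i, X = (β.flat i : Set α) := by
  obtain ⟨hXf, 𝒞, h𝒞, rfl⟩ := hX
  rcases 𝒞.eq_empty_or_nonempty with rfl | ⟨K, hK⟩
  · exact ⟨6, by simp [flat]⟩
  obtain ⟨i, hi6, hi⟩ := β.exists_flat_subset_of_isCircuit hk (h𝒞 K hK)
    (Set.subset_sUnion_of_mem hK) hXf
  have hXE : ⋃₀ 𝒞 ⊆ (β.ground : Set α) := hXf.subset_ground
  by_cases hi0 : i = 0
  · subst hi0
    exact ⟨0, Set.Subset.antisymm hXE hi⟩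
  obtain ⟨y, hy⟩ : (β.flat i).Nonempty :=
    Finset.card_pos.1 ((Nat.zero_le _).trans_lt (β.rank_lt hi0 hi6).2)
  obtain ⟨I, hIf, -, hI, hcard⟩ := β.exists_indep_subset_flat i hy
  have hIbas := β.isBasis_flat hIf hI hcard
  obtain ⟨J, hJ, hIJ⟩ := hI.subset_isBasis_of_subset ((Finset.coe_subset.2 hIf).trans hi)
    hXf.subset_ground
  have hJE := hJ.indep.subset_ground
  lift J to Finset α using β.matroid.set_finite _ hJE
  have hJg : J ⊆ β.ground := by exact_mod_cast hJE
  have hIJ' : I ⊆ J := by exact_mod_cast hIJ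
  -- If `X` has full rank, it is the ground set. Otherwise it must equal the flat that it contains.
  by_cases hJk : 2 * k ≤ J.card
  · refine ⟨0, Set.Subset.antisymm hXE ?_⟩
    have hJ2 : J.card = 2 * k := le_antisymm (by
      have := (β.indep_coe_iff.1 hJ.indep).2 0
      have h0 : β.flat 0 = β.ground := rfl
      rwa [h0, Finset.inter_eq_left.2 hJg] at this) hJk
    have hJb : β.matroid.IsBase (J : Set α) :=
      β.isBase_coe_iff.2 (β.indep_and_card_iff.1 ⟨hJ.indep, hJ2⟩)
    have h3 := (β.matroid.closure_subset_closure hJ.subset).trans hXf.closure.subset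
    rwa [hJb.closure_eq] at h3
  refine ⟨i, Set.Subset.antisymm (fun y hyX ↦ ?_) hi⟩
  -- An element of `X` outside `J` that is not in `flat i` would make `J` tight in a second flat, so
  -- `J` would have `2k` elements.
  have hout : ∀ z ∈ ⋃₀ 𝒞, z ∉ J → z ∈ β.flat i := by
    intro z hz hzJ
    have hdep : ¬ β.matroid.Indep ((insert z J : Finset α) : Set α) := by
      rw [Finset.coe_insert]
      exact (hJ.insert_dep ⟨hz, by simpa using hzJ⟩).not_indep
    rw [indep_coe_iff, not_and, not_forall] at hdep
    obtain ⟨j, hj⟩ := hdep (Finset.insert_subset (Finset.mem_coe.1 (hXE hz)) hJg)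
    have hJj := (β.indep_coe_iff.1 hJ.indep).2 j
    have hzj : z ∈ β.flat j := by
      by_contra hzj
      rw [Finset.insert_inter_of_notMem hzj] at hj
      exact hj hJj
    rw [Finset.insert_inter_of_mem hzj] at hj
    have := Finset.card_insert_le z (J ∩ β.flat j)
    by_cases hij : i = j
    · rwa [hij]
    have hi' : (J ∩ β.flat i).card = β.rank i := by
      refine le_antisymm ((β.indep_coe_iff.1 hJ.indep).2 i) ?_
      rw [← hcard]
      exact Finset.card_le_card (Finset.subset_inter hIJ' hIf)
    have := β.two_mul_le_card_of_tight hij hi6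
      (by rintro rfl; exact Finset.notMem_empty z hzj) hi' (by omega)
    omega
  by_cases hyJ : y ∈ J
  swap
  · exact hout y hyX hyJ
  by_contra hyf
  have hyf' : y ∉ β.flat i := hyf
  obtain ⟨L, hL, hyL⟩ := hyX
  have hLc := h𝒞 L hL
  -- An element `y` of `X` outside `flat i` belongs to `J`. The rest of a circuit through `y` lies
  -- in `J - y` or in `flat i`, which `I ⊆ J - y` spans. So `y` would be in the closure of `J - y`.
  have hsub : L \ {y} ⊆ β.matroid.closure ((J : Set α) \ {y}) := by
    rintro z ⟨hzL, hzy⟩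
    by_cases hzJ : z ∈ J
    · exact β.matroid.subset_closure _ (Set.sdiff_subset.trans hJE) ⟨hzJ, hzy⟩
    · have hzf := hout z ⟨L, hL, hzL⟩ hzJ
      have hzI : z ∈ β.matroid.closure (I : Set α) := by
        rw [hIbas.closure_eq_closure]
        exact β.matroid.subset_closure _ (Finset.coe_subset.2 (β.flat_subset_ground i)) hzf
      have hIy : (I : Set α) ⊆ (J : Set α) \ {y} :=
        Set.subset_sdiff_singleton hIJ fun h ↦ hyf' (hIf (Finset.mem_coe.1 h))
      exact β.matroid.closure_subset_closure hIy hzI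
  have hycl := β.matroid.closure_subset_closure_of_subset_closure hsub
    (hLc.mem_closure_sdiff_singleton_of_mem hyL)
  exact (indep_iff_forall_notMem_closure_sdiff hJE).1 hJ.indep (Finset.mem_coe.2 hyJ) hycl

theorem eq_matroid_iff (hk : 2 ≤ k) (β : BetaTuple α k) (N : Matroid α) :
    (N.E = (β.ground : Set α) ∧
      (∀ Z : Set α, N.IsCyclicFlat Z ↔ ∃ i, Z = (β.flat i : Set α)) ∧
      ∀ i, N.eRk (β.flat i : Set α) = (β.rank i : ℕ∞)) ↔ N = β.matroid := by
  constructor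
  · rintro ⟨hE, hcf, hr⟩
    have : N.Finite := ⟨hE ▸ β.ground.finite_toSet⟩
    refine ext_indep hE fun I hI ↦ ?_
    rw [indep_iff_of_isCyclicFlat hI, matroid_indep_iff, and_iff_right (hI.trans hE.subset)]
    constructor
    · intro h i
      rw [← hr]
      exact h _ ((hcf _).2 ⟨i, rfl⟩)
    · intro h Z hZ
      obtain ⟨i, rfl⟩ := (hcf Z).1 hZ
      rw [hr]
      exact h i
  · rintro rfl
    refine ⟨rfl, fun Z ↦ ⟨β.eq_flat_of_isCyclicFlat hk, ?_⟩, β.eRk_flat⟩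
    rintro ⟨i, rfl⟩
    exact β.isCyclicFlat_flat hk i

end BetaTuple

theorem mainTheorem3 {α : Type*} [DecidableEq α] (k : ℕ) (hk : 2 ≤ k) (β : BetaTuple α k) :
    -- `M_β` is the matroid on the union of the six sets whose cyclic flats are the seven
    -- members of `𝒵`, with the prescribed ranks; it has rank `2k`
    (∀ N : Matroid α,
      (N.E = (β.ground : Set α) ∧
        (∀ Z : Set α, N.IsCyclicFlat Z ↔ ∃ i, Z = (β.flat i : Set α)) ∧
        ∀ i, N.eRk (β.flat i : Set α) = (β.rank i : ℕ∞)) ↔ N = β.matroid) ∧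
    β.matroid.eRank = ((2 * k : ℕ) : ℕ∞) ∧
    -- (1)
    (¬ β.matroid.KBaseOrderable k ∧ ¬ β.matroid.StronglyBaseOrderable) ∧
    -- (2)
    (∀ x ∈ β.matroid.E, (β.matroid ／ {x}).IsTransversal) ∧
    -- (3)
    (β.matroid.IsExcludedMinor Matroid.StronglyBaseOrderable ∧
      β.matroid.IsExcludedMinor (Matroid.KBaseOrderable k)) ∧
    -- (4)
    β.matroid.KBaseOrderable (k - 1) ∧
    -- (5)
    ((2 * β.A.card = k ∧ 2 * β.B.card = k ∧ 2 * β.D.card = k ∧ 2 * β.E.card = k →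
        (β.matroid.pairsWithoutExchangeOrdering k).encard = 2) ∧
      (¬ (2 * β.A.card = k ∧ 2 * β.B.card = k ∧ 2 * β.D.card = k ∧ 2 * β.E.card = k) →
        (β.matroid.pairsWithoutExchangeOrdering k).encard = 1)) := by
  have hK := β.not_kBaseOrderable hk
  have hS : ¬ β.matroid.StronglyBaseOrderable := fun h ↦ hK (h.kBaseOrderable k)
  refine ⟨β.eq_matroid_iff hk, ?_, ⟨hK, hS⟩, β.contract_isTransversal hk,
    ⟨isExcludedMinor_of_allSwap hS (fun _ h ↦ h.stronglyBaseOrderable) (β.delete_allSwap hk)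
        (β.contract_allSwap hk),
      isExcludedMinor_of_allSwap hK (fun _ h ↦ h.kBaseOrderable k) (β.delete_allSwap hk)
        (β.contract_allSwap hk)⟩,
    β.kBaseOrderable_pred hk, β.encard_pairsWithoutExchangeOrdering_of_balanced hk,
    β.encard_pairsWithoutExchangeOrdering_of_not_balanced hk⟩
  rw [← β.blocks_ABC_isBase.encard_eq_eRank, Set.encard_coe_eq_coe_finsetCard,
    β.blocks_ABC_indep.2]
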